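/- Let $E$ be a Euclidean space with inner product $\langle\cdot,\cdot\rangle$, let $\|\cdot\|$ be an arbitrary norm on $E$ with unit ball $B=\{z:\|z\|\le 1\}$, and let $\|y\|_*=\sup_{\|z\|\le1}\langle z,y\rangle$ be the conjugate norm. Let $X\subset E$ be closed and convex, $(\Omega,P)$ a probability space, and $G:X\times\Omega\to\mathbb R$ such that for every $\omega$ the function $G(\cdot,\omega)$ is convex and differentiable on $X$ with $$\|\nabla G(x,\omega)-\nabla G(x',\omega)\|_*\le \mathcal L(\omega)\,\|x-x'\|\quad (x,x'\in X),\qquad \mathcal L(\omega)\le\nu\ \text{ a.s.},$$ where $\nu>0$. Let $g(x)=\mathbf E\{G(x,\omega)\}$ be finite, convex and differentiable on $X$, with $\mathbf E\{\nabla G(x,\omega)\}=\nabla g(x)$ for all $x\in X$. Let $x_*\in X$ satisfy $\nabla g(x_*)=0$ and, for some $\sigma_*>0$, $\mathbf E\{\exp(\|\nabla G(x_*,\omega)\|_*^2/\sigma_*^2)\}\le \exp(1)$. For $\kappa\ge 0$ put $F_\kappa(x)=\tfrac12 g(x)+\kappa\|x\|$. Let $\theta:B\to\mathbb R$ be convex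 and continuously differentiable, with $\theta(x)\ge\theta(0)=0$ and $\langle\nabla\theta(x)-\nabla\theta(x'),x-x'\rangle\ge\|x-x'\|^2$ for all $x,x'\in B$; put $\Theta=\max_{B}\theta$. For $x_0\in X$ and $R>0$ let $X_R(x_0)=\{z\in X:\|z-x_0\|\le R\}$, $\vartheta(z)=R^2\theta((z-x_0)/R)$, and $V(x,z)=\vartheta(z)-\vartheta(x)-\langle\nabla\vartheta(x),z-x\rangle$. Given a step size $\gamma>0$, i.i.d. samples $\omega_1,\omega_2,\dots$ with law $P$, and $h=\kappa\|\cdot\|$, composite stochastic mirror descent (CSMD) starts at $x_0$ and computes $$x_i=\operatorname*{argmin}_{z\in X_R(x_0)}\big\{\langle \gamma\nabla G(x_{i-1},\omega_i),z\rangle+\gamma h(z)+V(x_{i-1},z)\big\},\quad i=1,2,\dots,\qquad \widehat x_m=\frac1m\sum_{i=0}^{m-1}x_i .$$ For an integer $L\ge1$, the $L$-minibatch version uses, in place of $\nabla G(x_{i-1},\omega_i)$, the average $\frac1L\sum_{\ell=1}^L\nabla G(x^{(L)}_{i-1},\omega_i^\ell)$ over samples $\omega_i^\ell$ that are i.i.d.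 (in $i$ and $\ell$) with law $P$; its iterates are denoted $x_i^{(L)}$ and its output $\widehat x^{(L)}_m=\frac1m\sum_{i=0}^{m-1}x^{(L)}_i$. There are absolute constants $c,C>0$ such that the following holds in every such setting. If $0<\gamma\le(4\nu)^{-1}$ and $x_*\in X_R(x_0)$, then for every integer $m\ge1$ and every $t\ge c\sqrt{1+\ln m}$, with probability at least $1-4e^{-t}$, $$F_\kappa(\widehat x_m)-F_\kappa(x_*)\le C\,m^{-1}\big[\gamma^{-1}R^2(\Theta+t)+\kappa R+\gamma\sigma_*^2(m+t)\big],$$ and, for every integer $L\ge1$, with probability at least $1-4e^{-t}$, $$F_\kappa(\widehat x_m^{(L)})-F_\kappa(x_*)\le C\,m^{-1}\big[\gamma^{-1}R^2(\Theta+t)+\kappa R+\gamma\,\sigma_*^2\Theta L^{-1}(m+t)\big].$$ -/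

import Mathlib

/-!
Composite stochastic mirror descent on a Euclidean space `E` which carries, besides its inner
product, a second norm `p` (a seminorm that vanishes only at `0`).
-/

noncomputable section

namespace CSMD

variable {E : Type*} [NormedAddCommGroup E] [InnerProductSpace ℝ E]

/-- The conjugate norm `‖y‖_* = sup {⟨z, y⟩ : ‖z‖ ≤ 1}` of the norm `p`. -/
def dualNorm (p : Seminorm ℝ E) (y : E) : ℝ :=
  sSup ((fun z : E => inner ℝ z y) '' {z : E | p z ≤ 1})

/-- The ball `X_R(x₀) = {z ∈ X : ‖z - x₀‖ ≤ R}`. -/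
def localBall (p : Seminorm ℝ E) (X : Set E) (x₀ : E) (R : ℝ) : Set E :=
  {z : E | z ∈ X ∧ p (z - x₀) ≤ R}

/-- `θ`, with gradient `dθ`, is a distance-generating function of the unit ball of `p`,
normalized by `θ ≥ θ(0) = 0`: it is convex and continuously differentiable on the
(closed) unit ball and strongly convex there, with modulus one, with respect to `p`. -/
structure IsDGF [CompleteSpace E] (p : Seminorm ℝ E) (θ : E → ℝ) (dθ : E → E) : Prop where
  convexOn : ConvexOn ℝ {z : E | p z ≤ 1} θ
  hasGradient : ∀ z : E, p z ≤ 1 → HasGradientWithinAt θ (dθ z) {z : E | p z ≤ 1} z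
  continuousOn : ContinuousOn dθ {z : E | p z ≤ 1}
  strong : ∀ x z : E, p x ≤ 1 → p z ≤ 1 → p (x - z) ^ 2 ≤ inner ℝ (dθ x - dθ z) (x - z)
  zero : θ 0 = 0
  nonneg : ∀ z : E, p z ≤ 1 → 0 ≤ θ z

/-- `Θ`, the maximum of `θ` over the unit ball of `p`. -/
def bigTheta (p : Seminorm ℝ E) (θ : E → ℝ) : ℝ :=
  sSup (θ '' {z : E | p z ≤ 1})

/-- The local d.-g.f. `ϑ(z) = R² θ((z - x₀) / R)`. -/
def localDGF (θ : E → ℝ) (x₀ : E) (R : ℝ) (z : E) : ℝ :=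
  R ^ 2 * θ (R⁻¹ • (z - x₀))

/-- The gradient `R ∇θ((z - x₀) / R)` of the local d.-g.f. -/
def localDGFGrad (dθ : E → E) (x₀ : E) (R : ℝ) (z : E) : E :=
  R • dθ (R⁻¹ • (z - x₀))

/-- The Bregman divergence `V_{x₀}(x, z)` of the local d.-g.f. -/
def bregman (θ : E → ℝ) (dθ : E → E) (x₀ : E) (R : ℝ) (x z : E) : ℝ :=
  localDGF θ x₀ R z - localDGF θ x₀ R x - inner ℝ (localDGFGrad dθ x₀ R x) (z - x)

/-- `w` minimizes `⟨ζ, z⟩ + h(z) + V_{x₀}(x, z)` over `z ∈ X_R(x₀)`. -/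
def IsProx (p : Seminorm ℝ E) (X : Set E) (θ : E → ℝ) (dθ : E → E) (x₀ : E) (R : ℝ)
    (h : E → ℝ) (ζ x w : E) : Prop :=
  w ∈ localBall p X x₀ R ∧
    IsMinOn (fun z : E => inner ℝ ζ z + h z + bregman θ dθ x₀ R x z) (localBall p X x₀ R) w

/-- The composite proximal mapping `Prox_{h, x₀}(ζ, x)`: the minimizer selected by `IsProx`. (For a
d.-g.f., closed convex `X ∋ x₀`, `R > 0` and continuous convex `h` it exists and is unique.) -/
def prox (p : Seminorm ℝ E) (X : Set E) (θ : E → ℝ) (dθ : E → E) (x₀ : E) (R : ℝ)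
    (h : E → ℝ) (ζ x : E) : E :=
  Classical.epsilon (IsProx p X θ dθ x₀ R h ζ x)

/-- The iterates of composite mirror descent:
`x_{i+1} = Prox_{γ_{i+1} h, x₀}(γ_i H_i(x_i), x_i)`, started at `x₀`, where `H i x` is the value at
`x` of the gradient observation of step `i + 1`. -/
def iter (p : Seminorm ℝ E) (X : Set E) (θ : E → ℝ) (dθ : E → E) (x₀ : E) (R : ℝ)
    (h : E → ℝ) (γ : ℕ → ℝ) (H : ℕ → E → E) : ℕ → E
  | 0 => x₀
  | i + 1 =>
    prox p X θ dθ x₀ R (fun z => γ (i + 1) * h z)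
      (γ i • H i (iter p X θ dθ x₀ R h γ H i)) (iter p X θ dθ x₀ R h γ H i)

/-- The approximate solution after `m` steps, the `γ`-weighted mean of `x_0, …, x_{m-1}`. -/
def approxSol (p : Seminorm ℝ E) (X : Set E) (θ : E → ℝ) (dθ : E → E) (x₀ : E) (R : ℝ)
    (h : E → ℝ) (γ : ℕ → ℝ) (H : ℕ → E → E) (m : ℕ) : E :=
  (∑ i ∈ Finset.range m, γ i)⁻¹ • ∑ i ∈ Finset.range m, γ i • iter p X θ dθ x₀ R h γ H i

variable {Ω : Type*} [MeasurableSpace Ω]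

/-- The gradient observations of CSMD along a realization `ω` of the samples; `ω i` is the sample
used in step `i + 1`. -/
def oracle (dG : E → Ω → E) (ω : ℕ → Ω) : ℕ → E → E :=
  fun i x => dG x (ω i)

/-- The averaged gradient observations of `L`-minibatch CSMD. -/
def miniOracle (dG : E → Ω → E) (L : ℕ) (ω : ℕ → Fin L → Ω) : ℕ → E → E :=
  fun i x => (L : ℝ)⁻¹ • ∑ l : Fin L, dG x (ω i l)

/-- The objective `g(x) = 𝔼 G(x, ω)`, `ω ∼ P`. -/
def objective (P : MeasureTheory.Measure Ω) (G : E → Ω → ℝ) (x : E) : ℝ :=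
  ∫ ω, G x ω ∂P

/-- The composite objective `F_κ(x) = g(x) / 2 + κ ‖x‖`. -/
def compositeObjective (P : MeasureTheory.Measure Ω) (G : E → Ω → ℝ) (p : Seminorm ℝ E) (κ : ℝ)
    (x : E) : ℝ :=
  (1 / 2 : ℝ) * objective P G x + κ * p x

/-- The stochastic problem: a closed convex set `X`, and a random function `G(·, ω)`, convex on
`X`, with gradient `dG(·, ω)` which is Lipschitz on `X` from the norm `p` to its conjugate norm,
with a constant `lip ω` that is almost surely at most `ν`; the mean `g` of `G` is finite, convex
and differentiable on `X` with gradient `dg`, and `dG` is an unbiased estimate of `dg`.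
Values outside `X` play no role, and gradients are taken relative to `X`. -/
structure IsProblem [CompleteSpace E] [MeasurableSpace E] (p : Seminorm ℝ E) (X : Set E)
    (P : MeasureTheory.Measure Ω) (G : E → Ω → ℝ) (dG : E → Ω → E) (dg : E → E)
    (lip : Ω → ℝ) (ν : ℝ) : Prop where
  isClosed : IsClosed X
  convex : Convex ℝ X
  convexOn : ∀ ω, ConvexOn ℝ X (fun x => G x ω)
  hasGradient : ∀ ω, ∀ x ∈ X, HasGradientWithinAt (fun y => G y ω) (dG x ω) X x
  lipschitz : ∀ ω, ∀ x ∈ X, ∀ x' ∈ X, dualNorm p (dG x ω - dG x' ω) ≤ lip ω * p (x - x')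
  lip_le : ∀ᵐ ω ∂P, lip ω ≤ ν
  integrable : ∀ x ∈ X, MeasureTheory.Integrable (G x) P
  mean_convexOn : ConvexOn ℝ X (objective P G)
  mean_hasGradient : ∀ x ∈ X, HasGradientWithinAt (objective P G) (dg x) X x
  grad_measurable : ∀ x ∈ X, Measurable (dG x)
  grad_integrable : ∀ x ∈ X, MeasureTheory.Integrable (dG x) P
  unbiased : ∀ x ∈ X, ∫ ω, dG x ω ∂P = dg x

/-- `𝔼 exp(‖ξ‖_*² / σ²) ≤ exp 1` for a random vector `ξ` (used with `σ > 0`). -/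
def IsSubGaussian (p : Seminorm ℝ E) (P : MeasureTheory.Measure Ω) (ξ : Ω → E) (σ : ℝ) : Prop :=
  ∫⁻ ω, ENNReal.ofReal (Real.exp (dualNorm p (ξ ω) ^ 2 / σ ^ 2)) ∂P
    ≤ ENNReal.ofReal (Real.exp 1)

/-- `ξ` is a family of independent samples, defined on `(S, μ)`, each of them with law `P`. -/
def IsIIDSample {S ι : Type*} [MeasurableSpace S] (μ : MeasureTheory.Measure S)
    (P : MeasureTheory.Measure Ω) (ξ : ι → S → Ω) : Prop :=
  ProbabilityTheory.iIndepFun ξ μ ∧ ∀ i, MeasureTheory.MeasurePreserving (ξ i) μ P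

end CSMD

end

namespace CSMD

open Set Filter Topology MeasureTheory ProbabilityTheory
open scoped ENNReal

/-! ### The norm `p` and its conjugate in finite dimension -/

section Norm

variable {E : Type*} [NormedAddCommGroup E] [InnerProductSpace ℝ E]

/-! One step. Let y and w be consecutive iterates, ω the sample used between them, a = ∇G(y,ω) -
∇G(x_*,ω) and b = ∇G(x_*,ω). Comparing w with x_* in the prox inequality leaves ⟨a, y-w⟩ and ⟨b,
y-w⟩ to be paid for by p(y-w)²/2, the part of V(y,w) guaranteed by strong convexity. The b term
costs γ²‖b‖_*². For the a term, cocoercivity (`cocoercive`) gives ⟨a, y-w⟩² ≤ ν p(y-w)² ⟨a, y-x_*⟩,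
so for γν ≤ 1/4 it consumes only a quarter of γ⟨a, y-x_*⟩ (`step_bound`). Thus the noise enters only
through its size at x_*.

Concentration. The surviving 3/4 γ⟨a, y-x_*⟩ must be compared with its conditional mean. It is
nonnegative and bounded, so up to an exponentially controlled error it is at least 3/4 of that mean;
since (3/4)² = 9/16 ≥ 1/2, the bound carries g/2. The other random terms are γ²(‖b‖_*² - σ_*²) and
the centered -γ⟨b, y-x_*⟩. After normalization each of the three errors has conditional exponential
moment at most one, hence so has their weighted average `stepError`, by convexity of exp. The
product of the exponentials along the trajectory has mean at most one
(`lintegral_prod_process_le_one`), and a single Markov inequality bounds the sum of errors by t,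
with failure probability at most exp(-t). Telescoping V and Jensen's inequality finish `csmd_bound`.

Minibatches. Minibatch descent is plain descent on Ω^L for the averaged function, with the same ν.
It remains to see that the averaged gradient at x_* is sub-Gaussian with squared parameter 96 Θ
σ_*²/L. The maximum over the unit ball of ⟨y,z⟩ - βθ(z) is a potential which is at least ‖y‖_* - βΘ,
and along a sum it grows by a centered linear term plus a quadratic one. This bounds the exponential
moments of the norm of the sum (`lintegral_exp_dualNorm_sum_le`); integrating them against a
Gaussian bounds the exponential moment of its square (`lintegral_exp_sq_le_one`). -/

theorem seminorm_continuous [FiniteDimensional ℝ E] (p : Seminorm ℝ E) : Continuous p :=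
  p.convexOn.locallyLipschitz.continuous

theorem exists_norm_le_mul [FiniteDimensional ℝ E] (p : Seminorm ℝ E)
    (hp : ∀ x : E, p x = 0 → x = 0) : ∃ K : ℝ, 0 < K ∧ ∀ x : E, ‖x‖ ≤ K * p x := by
  rcases subsingleton_or_nontrivial E with hE | hE
  · exact ⟨1, one_pos, fun x => by simp [Subsingleton.elim x 0]⟩
  have hne : (Metric.sphere (0 : E) 1).Nonempty := NormedSpace.sphere_nonempty.2 zero_le_one
  obtain ⟨u, hu, hmin⟩ := (isCompact_sphere (0 : E) 1).exists_isMinOn hne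
    (seminorm_continuous p).continuousOn
  have hu1 : ‖u‖ = 1 := by simpa using hu
  have hpu : 0 < p u := by
    refine lt_of_le_of_ne (apply_nonneg p u) fun h => ?_
    have := hp u h.symm
    simp [this] at hu1
  refine ⟨(p u)⁻¹, inv_pos.2 hpu, fun x => ?_⟩
  rcases eq_or_ne x 0 with rfl | hx
  · simp
  have hx' : 0 < ‖x‖ := norm_pos_iff.2 hx
  have h1 : ‖x‖⁻¹ • x ∈ Metric.sphere (0 : E) 1 := by
    simp [norm_smul, hx'.ne']
  have h2 : p u ≤ ‖x‖⁻¹ * p x := by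
    have := hmin h1
    simpa [map_smul_eq_mul] using this
  rw [inv_mul_eq_div, le_div_iff₀ hpu]
  rw [inv_mul_eq_div, le_div_iff₀ hx'] at h2
  linarith

theorem isCompact_seminorm_closedBall [FiniteDimensional ℝ E] (p : Seminorm ℝ E)
    (hp : ∀ x : E, p x = 0 → x = 0) (x₀ : E) (R : ℝ) : IsCompact {z : E | p (z - x₀) ≤ R} := by
  obtain ⟨K, hK, hle⟩ := exists_norm_le_mul p hp
  refine Metric.isCompact_of_isClosed_isBounded ?_ ?_
  · exact isClosed_le ((seminorm_continuous p).comp (continuous_id.sub continuous_const))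
      continuous_const
  · refine (Metric.isBounded_closedBall (x := x₀) (r := K * R)).subset fun z hz => ?_
    rw [Metric.mem_closedBall, dist_eq_norm]
    exact (hle _).trans (mul_le_mul_of_nonneg_left hz hK.le)

theorem dualNorm_bddAbove [FiniteDimensional ℝ E] (p : Seminorm ℝ E)
    (hp : ∀ x : E, p x = 0 → x = 0) (y : E) :
    BddAbove ((fun z : E => inner ℝ z y) '' {z : E | p z ≤ 1}) := by
  have := isCompact_seminorm_closedBall p hp 0 1
  simp only [sub_zero] at this
  exact (this.image (by fun_prop)).bddAbove

theorem inner_le_dualNorm_mul [FiniteDimensional ℝ E] (p : Seminorm ℝ E)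
    (hp : ∀ x : E, p x = 0 → x = 0) (y z : E) : inner ℝ y z ≤ dualNorm p y * p z := by
  rcases eq_or_ne z 0 with rfl | hz
  · simp
  have hz' : 0 < p z := lt_of_le_of_ne (apply_nonneg p z) fun h => hz (hp z h.symm)
  have : inner ℝ ((p z)⁻¹ • z) y ≤ dualNorm p y := by
    refine le_csSup (dualNorm_bddAbove p hp y) ⟨_, ?_, rfl⟩
    simp [map_smul_eq_mul, abs_of_pos hz', hz'.ne']
  rw [real_inner_smul_left, inv_mul_eq_div, div_le_iff₀ hz', real_inner_comm] at this
  exact this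

theorem dualNorm_le (p : Seminorm ℝ E) {y : E} {c : ℝ}
    (h : ∀ z, p z ≤ 1 → inner ℝ y z ≤ c) : dualNorm p y ≤ c := by
  refine csSup_le ⟨_, 0, by simp, rfl⟩ ?_
  rintro _ ⟨z, hz, rfl⟩
  simpa [real_inner_comm] using h z hz

theorem dualNorm_nonneg [FiniteDimensional ℝ E] (p : Seminorm ℝ E)
    (hp : ∀ x : E, p x = 0 → x = 0) (y : E) : 0 ≤ dualNorm p y :=
  le_csSup (dualNorm_bddAbove p hp y) ⟨0, by simp, by simp⟩

theorem abs_inner_le_dualNorm_mul [FiniteDimensional ℝ E] (p : Seminorm ℝ E)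
    (hp : ∀ x : E, p x = 0 → x = 0) (y z : E) : |inner ℝ y z| ≤ dualNorm p y * p z := by
  refine abs_le.2 ⟨?_, inner_le_dualNorm_mul p hp y z⟩
  have := inner_le_dualNorm_mul p hp y (-z)
  rw [inner_neg_right, map_neg_eq_map] at this
  linarith

theorem dualNorm_add_le [FiniteDimensional ℝ E] (p : Seminorm ℝ E)
    (hp : ∀ x : E, p x = 0 → x = 0) (y z : E) :
    dualNorm p (y + z) ≤ dualNorm p y + dualNorm p z := by
  refine dualNorm_le p fun w hw => ?_
  rw [inner_add_left]
  have h1 := inner_le_dualNorm_mul p hp y w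
  have h2 := inner_le_dualNorm_mul p hp z w
  nlinarith [dualNorm_nonneg p hp y, dualNorm_nonneg p hp z]

theorem dualNorm_smul_le [FiniteDimensional ℝ E] (p : Seminorm ℝ E)
    (hp : ∀ x : E, p x = 0 → x = 0) {c : ℝ} (hc : 0 ≤ c) (y : E) :
    dualNorm p (c • y) ≤ c * dualNorm p y := by
  refine dualNorm_le p fun w hw => ?_
  rw [real_inner_smul_left]
  have h1 := inner_le_dualNorm_mul p hp y w
  have := dualNorm_nonneg p hp y
  exact mul_le_mul_of_nonneg_left (by nlinarith) hc

theorem dualNorm_sum_le [FiniteDimensional ℝ E] (p : Seminorm ℝ E)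
    (hp : ∀ x : E, p x = 0 → x = 0) {ι : Type*} (s : Finset ι) (f : ι → E) :
    dualNorm p (∑ i ∈ s, f i) ≤ ∑ i ∈ s, dualNorm p (f i) := by
  classical
  induction s using Finset.induction_on with
  | empty => simpa using dualNorm_le p (y := (0 : E)) (c := 0) (by simp)
  | insert a s ha ih =>
    rw [Finset.sum_insert ha, Finset.sum_insert ha]
    exact (dualNorm_add_le p hp _ _).trans (by linarith)

theorem dualNorm_le_mul_norm (p : Seminorm ℝ E) {K : ℝ}
    (hle : ∀ x : E, ‖x‖ ≤ K * p x) (hK : 0 ≤ K) (y : E) : dualNorm p y ≤ K * ‖y‖ := by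
  refine dualNorm_le p fun z hz => ?_
  refine (real_inner_le_norm y z).trans ?_
  rw [mul_comm]
  refine mul_le_mul_of_nonneg_right ((hle z).trans ?_) (norm_nonneg y)
  nlinarith

theorem dualNorm_continuous [FiniteDimensional ℝ E] (p : Seminorm ℝ E)
    (hp : ∀ x : E, p x = 0 → x = 0) : Continuous (dualNorm p) := by
  obtain ⟨K, hK, hle⟩ := exists_norm_le_mul p hp
  have key : ∀ x y, dualNorm p x ≤ dualNorm p y + K * ‖x - y‖ := fun x y => by
    have := dualNorm_add_le p hp y (x - y)
    rw [add_sub_cancel] at this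
    linarith [dualNorm_le_mul_norm p hle hK.le (x - y)]
  refine (LipschitzWith.of_le_add_mul ⟨K, hK.le⟩ fun x y => ?_).continuous
  rw [dist_eq_norm]
  exact key x y

/-- The norm of a vector is controlled by its conjugate norm. -/
theorem exists_norm_le_mul_dualNorm [FiniteDimensional ℝ E] (p : Seminorm ℝ E)
    (hp : ∀ x : E, p x = 0 → x = 0) : ∃ K : ℝ, 0 ≤ K ∧ ∀ y : E, ‖y‖ ≤ K * dualNorm p y := by
  obtain ⟨u, hu⟩ := (isCompact_closedBall (0 : E) 1).exists_isMaxOn ⟨0, by simp⟩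
    (seminorm_continuous p).continuousOn
  refine ⟨p u, apply_nonneg p u, fun y => ?_⟩
  rcases eq_or_ne y 0 with rfl | hy
  · simpa using mul_nonneg (apply_nonneg p u) (dualNorm_nonneg p hp 0)
  have hy' : 0 < ‖y‖ := norm_pos_iff.2 hy
  have h1 : p (‖y‖⁻¹ • y) ≤ p u := hu.2 (by simp [norm_smul, hy'.ne'])
  have h2 := inner_le_dualNorm_mul p hp y (‖y‖⁻¹ • y)
  rw [real_inner_smul_right, real_inner_self_eq_norm_sq, sq, inv_mul_cancel_left₀ hy'.ne'] at h2
  nlinarith [dualNorm_nonneg p hp y]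

end Norm

/-! ### First-order inequalities along segments of a convex set -/

section Line

variable {E : Type*} [NormedAddCommGroup E] [InnerProductSpace ℝ E] [CompleteSpace E]

/-- Gradients exist only relative to a convex set, possibly with empty interior. Every inequality
below is therefore reduced to a function on `[0, 1]` along a segment of that set. -/
theorem hasDerivWithinAt_line {K : Set E} (hK : Convex ℝ K) {f : E → ℝ} {x z : E}
    (hx : x ∈ K) (hz : z ∈ K) {t : ℝ} {d : E}
    (hf : HasGradientWithinAt f d K (x + t • (z - x))) :
    HasDerivWithinAt (fun s : ℝ => f (x + s • (z - x))) (inner ℝ d (z - x)) (Icc 0 1) t := by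
  have h1 : HasDerivWithinAt (fun s : ℝ => x + s • (z - x)) (z - x) (Icc 0 1) t := by
    simpa using (((hasDerivAt_id t).smul_const (z - x)).const_add x).hasDerivWithinAt
  have := (hasGradientWithinAt_iff_hasFDerivWithinAt.1 hf).comp_hasDerivWithinAt t h1
    (fun s hs => hK.add_smul_sub_mem hx hz hs)
  rwa [InnerProductSpace.toDual_apply_apply] at this

/-- A function on `[0, 1]` whose derivative grows at least linearly. -/
theorem add_half_le_of_deriv {φ φ' : ℝ → ℝ} {a : ℝ}
    (hφ : ∀ t ∈ Icc (0 : ℝ) 1, HasDerivWithinAt φ (φ' t) (Icc 0 1) t)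
    (h : ∀ t ∈ Ioo (0 : ℝ) 1, t * a ≤ φ' t - φ' 0) : φ 0 + φ' 0 + a / 2 ≤ φ 1 := by
  let ψ : ℝ → ℝ := fun t => φ t - φ' 0 * t - a / 2 * t ^ 2
  have hψ : ∀ t ∈ Icc (0 : ℝ) 1,
      HasDerivWithinAt ψ (φ' t - φ' 0 - a * t) (Icc 0 1) t := fun t ht => by
    have h1 := ((hφ t ht).sub ((hasDerivAt_id t).const_mul (φ' 0)).hasDerivWithinAt).sub
      (((hasDerivAt_id t).pow 2).const_mul (a / 2)).hasDerivWithinAt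
    refine h1.congr_deriv ?_
    simp
    ring
  have hmono : MonotoneOn ψ (Icc 0 1) := by
    refine monotoneOn_of_hasDerivWithinAt_nonneg (convex_Icc 0 1)
      (fun t ht => (hψ t ht).continuousWithinAt) (f' := fun t => φ' t - φ' 0 - a * t)
      (fun t ht => ?_) (fun t ht => ?_)
    · rw [interior_Icc] at ht ⊢
      exact (hψ t (Ioo_subset_Icc_self ht)).mono Ioo_subset_Icc_self
    · rw [interior_Icc] at ht
      linarith [h t ht]
  have := hmono (left_mem_Icc.2 zero_le_one) (right_mem_Icc.2 zero_le_one) zero_le_one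
  simp only [ψ] at this
  linarith

theorem bregman_lower {p : Seminorm ℝ E} {K : Set E} (hK : Convex ℝ K) {f : E → ℝ} {d : E → E}
    (hf : ∀ x ∈ K, HasGradientWithinAt f (d x) K x) {c : ℝ}
    (hd : ∀ x ∈ K, ∀ z ∈ K, c * p (x - z) ^ 2 ≤ inner ℝ (d x - d z) (x - z))
    {x z : E} (hx : x ∈ K) (hz : z ∈ K) :
    c / 2 * p (z - x) ^ 2 ≤ f z - f x - inner ℝ (d x) (z - x) := by
  have := add_half_le_of_deriv (φ := fun s : ℝ => f (x + s • (z - x)))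
    (φ' := fun s : ℝ => inner ℝ (d (x + s • (z - x))) (z - x)) (a := c * p (z - x) ^ 2)
    (fun t ht => hasDerivWithinAt_line hK hx hz
      (hf _ (hK.add_smul_sub_mem hx hz ht))) ?_
  · simp at this
    linarith
  intro t ht
  have h := hd (x + t • (z - x)) (hK.add_smul_sub_mem hx hz (Ioo_subset_Icc_self ht)) x hx
  rw [add_sub_cancel_left, map_smul_eq_mul, real_inner_smul_right, Real.norm_of_nonneg ht.1.le,
    mul_pow] at h
  have h' : t * (t * (c * p (z - x) ^ 2)) ≤ t * inner ℝ (d (x + t • (z - x)) - d x) (z - x) := by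
    linarith
  have := le_of_mul_le_mul_left h' ht.1
  simpa [inner_sub_left] using this

theorem bregman_upper {p : Seminorm ℝ E} {K : Set E} (hK : Convex ℝ K) {f : E → ℝ} {d : E → E}
    (hf : ∀ x ∈ K, HasGradientWithinAt f (d x) K x) {c : ℝ}
    (hd : ∀ x ∈ K, ∀ z ∈ K, inner ℝ (d x - d z) (x - z) ≤ c * p (x - z) ^ 2)
    {x z : E} (hx : x ∈ K) (hz : z ∈ K) :
    f z - f x - inner ℝ (d x) (z - x) ≤ c / 2 * p (z - x) ^ 2 := by
  -- The lower bound puts no sign condition on `c`, so it applies to `-f` with `-c`.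
  have := bregman_lower (p := p) hK (f := fun x => -f x) (d := fun x => -d x) (c := -c)
    (fun x hx => by
      rw [hasGradientWithinAt_iff_hasFDerivWithinAt]
      rw [map_neg]
      exact (hasGradientWithinAt_iff_hasFDerivWithinAt.1 (hf x hx)).neg)
    (fun x hx z hz => by
      have := hd x hx z hz
      rw [← neg_sub', inner_neg_left]
      linarith) hx hz
  rw [inner_neg_left] at this
  linarith

theorem inner_gradient_le {K : Set E} {f : E → ℝ} (hf : ConvexOn ℝ K f)
    {x z d : E} (hx : x ∈ K) (hz : z ∈ K) (hd : HasGradientWithinAt f d K x) :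
    inner ℝ d (z - x) ≤ f z - f x := by
  have h1 : HasDerivWithinAt (fun s : ℝ => f (x + s • (z - x))) (inner ℝ d (z - x))
      (Icc 0 1) 0 := hasDerivWithinAt_line hf.1 hx hz (by simpa using hd)
  have h2 : ConvexOn ℝ (Icc (0 : ℝ) 1) (fun s : ℝ => f (x + s • (z - x))) := by
    refine ⟨convex_Icc 0 1, fun a ha b hb s t hs ht hst => ?_⟩
    have := hf.2 (hf.1.add_smul_sub_mem hx hz ha) (hf.1.add_smul_sub_mem hx hz hb)
      hs ht hst
    convert this using 2
    have : s • x + t • x = x := by rw [← add_smul, hst, one_smul]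
    nth_rewrite 1 [← this]
    simp only [smul_add, add_smul, smul_smul, smul_eq_mul]
    abel
  have := h2.le_slope_of_hasDerivWithinAt (left_mem_Icc.2 zero_le_one)
    (right_mem_Icc.2 zero_le_one) zero_lt_one h1
  simpa [slope] using this

end Line

/-! ### Cocoercivity relative to a convex set -/

section Cocoercive

variable {E : Type*} [NormedAddCommGroup E] [InnerProductSpace ℝ E] [FiniteDimensional ℝ E]
  [CompleteSpace E]

omit [FiniteDimensional ℝ E] in
-- Compare `f` at the point `x - s • w`: smoothness at `x` bounds it above, convexity at `y` bounds
-- it below, and the stated multiple `s` optimizes the resulting quadratic.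
theorem cocoercive_half {p : Seminorm ℝ E} {K : Set E} {f : E → ℝ} {d : E → E} {ν : ℝ}
    (hν : 0 < ν) (hf : ConvexOn ℝ K f) (hd : ∀ x ∈ K, HasGradientWithinAt f (d x) K x)
    (hlip : ∀ x ∈ K, ∀ z ∈ K, inner ℝ (d x - d z) (x - z) ≤ ν * p (x - z) ^ 2)
    {x y w : E} (hx : x ∈ K) (hy : y ∈ K) (hw : 0 < p w)
    (hs : x - (inner ℝ (d x - d y) w / (ν * p w ^ 2)) • w ∈ K) :
    inner ℝ (d x - d y) w ^ 2 / (2 * (ν * p w ^ 2)) ≤ f x - f y - inner ℝ (d y) (x - y) := by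
  set g := inner ℝ (d x - d y) w with hg
  set s := g / (ν * p w ^ 2) with hsdef
  have h1 := inner_gradient_le hf hy hs (hd y hy)
  have h2 := bregman_upper (p := p) hf.1 hd hlip hx hs
  have e1 : x - s • w - x = -(s • w) := by abel
  have e2 : x - s • w - y = (x - y) - s • w := by abel
  rw [e1, map_neg_eq_map, map_smul_eq_mul, inner_neg_right, real_inner_smul_right, mul_pow,
    Real.norm_eq_abs, sq_abs] at h2
  rw [e2, inner_sub_right, real_inner_smul_right] at h1
  have h3 : g = inner ℝ (d x) w - inner ℝ (d y) w := by rw [hg, inner_sub_left]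
  have hpos : 0 < ν * p w ^ 2 := by positivity
  have h4 : s * g - ν / 2 * (s ^ 2 * p w ^ 2) = g ^ 2 / (2 * (ν * p w ^ 2)) := by
    rw [hsdef]; field_simp; ring
  rw [← h4, h3]
  linarith

theorem cocoercive_local {p : Seminorm ℝ E} (hp : ∀ x : E, p x = 0 → x = 0)
    {K : Set E} {f : E → ℝ} {d : E → E} {ν : ℝ}
    (hν : 0 < ν) (hf : ConvexOn ℝ K f) (hd : ∀ x ∈ K, HasGradientWithinAt f (d x) K x)
    (hlip : ∀ x ∈ K, ∀ z ∈ K, dualNorm p (d x - d z) ≤ ν * p (x - z))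
    {x y w : E} {δ : ℝ} (hw : 0 < p w) (hδ : 0 ≤ δ) (hxy : p (x - y) ≤ δ * p w)
    (hx : ∀ s : ℝ, |s| ≤ δ → x + s • w ∈ K) (hy : ∀ s : ℝ, |s| ≤ δ → y + s • w ∈ K) :
    inner ℝ (d x - d y) w ^ 2 ≤ ν * p w ^ 2 * inner ℝ (d x - d y) (x - y) := by
  have hlip' : ∀ x ∈ K, ∀ z ∈ K, inner ℝ (d x - d z) (x - z) ≤ ν * p (x - z) ^ 2 :=
    fun x hx z hz => by
      have h1 := inner_le_dualNorm_mul p hp (d x - d z) (x - z)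
      have h2 := mul_le_mul_of_nonneg_right (hlip x hx z hz) (apply_nonneg p (x - z))
      nlinarith
  have hxK : x ∈ K := by simpa using hx 0 (by simpa using hδ)
  have hyK : y ∈ K := by simpa using hy 0 (by simpa using hδ)
  have hpos : 0 < ν * p w ^ 2 := by positivity
  set g := inner ℝ (d x - d y) w with hg
  -- The Lipschitz bound gives |g| ≤ ν p(x - y) p(w), so the optimal step is at most p(x - y)/p(w),
  -- and closeness of `x` and `y` keeps it within the available room.
  have hgle : |g / (ν * p w ^ 2)| ≤ δ := by
    rw [abs_div, abs_of_pos hpos, div_le_iff₀ hpos]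
    have h1 := abs_inner_le_dualNorm_mul p hp (d x - d y) w
    have h2 := mul_le_mul_of_nonneg_right (hlip x hxK y hyK) hw.le
    have h3 := mul_le_mul_of_nonneg_right hxy (mul_nonneg hν.le hw.le)
    rw [← hg] at h1
    nlinarith
  have h1 := cocoercive_half hν hf hd hlip' hxK hyK hw (by
    rw [sub_eq_add_neg, ← neg_smul]
    exact hx _ (by rwa [abs_neg]))
  have hg' : inner ℝ (d y - d x) w = -g := by rw [← neg_sub, inner_neg_left]
  have h2 := cocoercive_half hν hf hd hlip' hyK hxK hw (by
    rw [hg', neg_div, neg_smul, sub_neg_eq_add]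
    exact hy _ hgle)
  rw [hg', neg_sq] at h2
  have h3 : g ^ 2 / (2 * (ν * p w ^ 2)) + g ^ 2 / (2 * (ν * p w ^ 2)) ≤
      inner ℝ (d x - d y) (x - y) := by
    have : inner ℝ (d x) (y - x) = - inner ℝ (d x) (x - y) := by rw [← neg_sub, inner_neg_right]
    rw [inner_sub_left]
    linarith
  have h4 : g ^ 2 / (2 * (ν * p w ^ 2)) + g ^ 2 / (2 * (ν * p w ^ 2)) = g ^ 2 / (ν * p w ^ 2) := by
    field_simp; ring
  rw [h4, div_le_iff₀ hpos] at h3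
  linarith

/-- The segment from `y` to `x` is cut into `N` pieces short enough for `cocoercive_local`. Summing
costs a factor `N` by Cauchy–Schwarz, which cancels the factor 1/N in each increment of `x - y`. -/
theorem cocoercive_of_room {p : Seminorm ℝ E} (hp : ∀ x : E, p x = 0 → x = 0)
    {K : Set E} {f : E → ℝ} {d : E → E} {ν : ℝ}
    (hν : 0 < ν) (hf : ConvexOn ℝ K f) (hd : ∀ x ∈ K, HasGradientWithinAt f (d x) K x)
    (hlip : ∀ x ∈ K, ∀ z ∈ K, dualNorm p (d x - d z) ≤ ν * p (x - z))
    {x y w : E} {δ : ℝ} (hw : 0 < p w) (hδ : 0 < δ)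
    (hx : ∀ s : ℝ, |s| ≤ δ → x + s • w ∈ K) (hy : ∀ s : ℝ, |s| ≤ δ → y + s • w ∈ K) :
    inner ℝ (d x - d y) w ^ 2 ≤ ν * p w ^ 2 * inner ℝ (d x - d y) (x - y) := by
  obtain ⟨N, hN⟩ := exists_nat_gt (p (x - y) / (δ * p w))
  have hδw : 0 < δ * p w := by positivity
  have hN0 : (0 : ℝ) < N := lt_of_le_of_lt (div_nonneg (apply_nonneg p _) hδw.le) hN
  let c : ℕ → E := fun k => y + ((k : ℝ) / N) • (x - y)
  have hc0 : c 0 = y := by simp [c]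
  have hcN : c N = x := by simp [c, hN0.ne']
  have hstep : ∀ k, c (k + 1) - c k = (N : ℝ)⁻¹ • (x - y) := fun k => by
    simp only [c, add_sub_add_left_eq_sub, ← sub_smul]
    congr 1
    push_cast
    field_simp
    ring
  have hcK : ∀ k ≤ N, ∀ s : ℝ, |s| ≤ δ → c k + s • w ∈ K := fun k hk s hs => by
    have hk' : (k : ℝ) / N ∈ Icc (0 : ℝ) 1 :=
      ⟨by positivity, (div_le_one hN0).2 (by exact_mod_cast hk)⟩
    have := hf.1.add_smul_sub_mem (hy s hs) (hx s hs) hk'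
    convert this using 1
    simp only [c, add_sub_add_right_eq_sub]
    abel
  have hk : ∀ k ∈ Finset.range N, inner ℝ (d (c (k + 1)) - d (c k)) w ^ 2 ≤
      ν * p w ^ 2 * ((N : ℝ)⁻¹ * inner ℝ (d (c (k + 1)) - d (c k)) (x - y)) := fun k hk => by
    have hkN := Finset.mem_range.1 hk
    have := cocoercive_local hp hν hf hd hlip hw hδ.le (x := c (k + 1)) (y := c k) ?_
      (hcK _ hkN) (hcK _ hkN.le)
    · rwa [hstep, real_inner_smul_right] at this
    · rw [hstep, map_smul_eq_mul, Real.norm_of_nonneg (by positivity), inv_mul_le_iff₀ hN0]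
      rw [div_lt_iff₀ hδw] at hN
      exact hN.le
  have hsum : ∀ v : E, ∑ k ∈ Finset.range N, inner ℝ (d (c (k + 1)) - d (c k)) v =
      inner ℝ (d x - d y) v := fun v => by
    rw [← sum_inner, Finset.sum_range_sub (fun k => d (c k)), hc0, hcN]
  have h1 := Finset.sum_le_sum hk
  rw [← Finset.mul_sum, ← Finset.mul_sum, hsum] at h1
  have h2 := sq_sum_le_card_mul_sum_sq (s := Finset.range N)
    (f := fun k => inner ℝ (d (c (k + 1)) - d (c k)) w)
  rw [hsum, Finset.card_range] at h2
  calc inner ℝ (d x - d y) w ^ 2 ≤ N * _ := h2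
    _ ≤ N * _ := mul_le_mul_of_nonneg_left h1 hN0.le
    _ = _ := by field_simp

omit [CompleteSpace E] in
theorem gradient_continuousOn {p : Seminorm ℝ E} (hp : ∀ x : E, p x = 0 → x = 0)
    {K : Set E} {d : E → E} {ν : ℝ}
    (hlip : ∀ x ∈ K, ∀ z ∈ K, dualNorm p (d x - d z) ≤ ν * p (x - z)) : ContinuousOn d K := by
  obtain ⟨C, hC, hle⟩ := exists_norm_le_mul_dualNorm p hp
  intro x hx
  rw [ContinuousWithinAt, tendsto_iff_norm_sub_tendsto_zero]
  have hlim : Tendsto (fun y => C * (ν * p (y - x))) (𝓝[K] x) (𝓝 0) := by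
    have : Continuous fun y => C * (ν * p (y - x)) := by
      have := seminorm_continuous p
      fun_prop
    have := (this.tendsto x).mono_left (nhdsWithin_le_nhds (s := K))
    simpa using this
  refine squeeze_zero' (Eventually.of_forall fun _ => norm_nonneg _) ?_ hlim
  filter_upwards [self_mem_nhdsWithin] with y hy
  exact (hle _).trans (mul_le_mul_of_nonneg_left (hlip y hy x hx) hC)

/-- Cocoercivity of the gradient of a convex function with Lipschitz gradient on an arbitrary
convex set, in the directions of that set. -/
theorem cocoercive {p : Seminorm ℝ E} (hp : ∀ x : E, p x = 0 → x = 0)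
    {K : Set E} {f : E → ℝ} {d : E → E} {ν : ℝ}
    (hν : 0 < ν) (hf : ConvexOn ℝ K f) (hd : ∀ x ∈ K, HasGradientWithinAt f (d x) K x)
    (hlip : ∀ x ∈ K, ∀ z ∈ K, dualNorm p (d x - d z) ≤ ν * p (x - z))
    {x y z z' : E} (hx : x ∈ K) (hy : y ∈ K) (hz : z ∈ K) (hz' : z' ∈ K) :
    inner ℝ (d x - d y) (z - z') ^ 2 ≤ ν * p (z - z') ^ 2 * inner ℝ (d x - d y) (x - y) := by
  rcases eq_or_ne (z - z') 0 with h0 | hne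
  · simp [h0]
  have hw : 0 < p (z - z') := lt_of_le_of_ne (apply_nonneg p _) fun h => hne (hp _ h.symm)
  -- Neither `x` nor `y` need have room in the direction `z - z'`. Moving both a fraction ε towards
  -- the midpoint `q` of `z` and `z'` creates room ε/2; then ε → 0, by continuity of the gradient.
  set q : E := z' + (1 / 2 : ℝ) • (z - z') with hq
  have hcont := gradient_continuousOn hp hlip
  have hroom : ∀ v ∈ K, ∀ ε ∈ Ioc (0 : ℝ) 1, ∀ s : ℝ, |s| ≤ ε / 2 →
      v + ε • (q - v) + s • (z - z') ∈ K := fun v hv ε hε s hs => by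
    have hr : 1 / 2 + s / ε ∈ Icc (0 : ℝ) 1 := by
      have : |s / ε| ≤ 1 / 2 := by
        rw [abs_div, abs_of_pos hε.1, div_le_iff₀ hε.1]
        linarith
      have := abs_le.1 this
      constructor <;> linarith
    have h1 := hf.1.add_smul_sub_mem hz' hz hr
    have h2 := hf.1.add_smul_sub_mem hv h1 ⟨hε.1.le, hε.2⟩
    convert h2 using 1
    have : s = ε * (s / ε) := by field_simp [hε.1.ne']
    nth_rewrite 1 [this]
    simp only [hq, add_smul, smul_sub, smul_add, mul_smul]
    abel
  have hq' : q ∈ K := hf.1.add_smul_sub_mem hz' hz ⟨by norm_num, by norm_num⟩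
  have hev : ∀ᶠ ε : ℝ in 𝓝[>] 0, inner ℝ (d (x + ε • (q - x)) - d (y + ε • (q - y))) (z - z') ^ 2 ≤
      ν * p (z - z') ^ 2 * inner ℝ (d (x + ε • (q - x)) - d (y + ε • (q - y)))
        (x + ε • (q - x) - (y + ε • (q - y))) := by
    filter_upwards [Ioc_mem_nhdsGT (zero_lt_one (α := ℝ))] with ε hε
    exact cocoercive_of_room hp hν hf hd hlip hw (half_pos hε.1) (hroom x hx ε hε) (hroom y hy ε hε)
  have hpt : ∀ v ∈ K, Tendsto (fun ε : ℝ => v + ε • (q - v)) (𝓝[>] 0) (𝓝[K] v) := fun v hv => by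
    refine tendsto_nhdsWithin_iff.2 ⟨?_, ?_⟩
    · have : Continuous fun ε : ℝ => v + ε • (q - v) := by fun_prop
      have := (this.tendsto 0).mono_left (nhdsWithin_le_nhds (s := Ioi 0))
      simpa using this
    · filter_upwards [Ioc_mem_nhdsGT (zero_lt_one (α := ℝ))] with ε hε
      exact hf.1.add_smul_sub_mem hv hq' ⟨hε.1.le, hε.2⟩
  have hdt : Tendsto (fun ε : ℝ => d (x + ε • (q - x)) - d (y + ε • (q - y))) (𝓝[>] 0)
      (𝓝 (d x - d y)) :=
    ((hcont x hx).tendsto.comp (hpt x hx)).sub ((hcont y hy).tendsto.comp (hpt y hy))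
  have hxt : Tendsto (fun ε : ℝ => x + ε • (q - x) - (y + ε • (q - y))) (𝓝[>] 0) (𝓝 (x - y)) :=
    ((hpt x hx).mono_right nhdsWithin_le_nhds).sub ((hpt y hy).mono_right nhdsWithin_le_nhds)
  exact le_of_tendsto_of_tendsto ((hdt.inner tendsto_const_nhds).pow 2)
    ((hdt.inner hxt).const_mul _) hev

end Cocoercive

/-! ### Minimizers of composite problems and their stability -/

section Argmin

variable {E : Type*} [NormedAddCommGroup E] [InnerProductSpace ℝ E]

theorem deriv_nonneg_of_isMinOn_left {φ : ℝ → ℝ} {a : ℝ}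
    (hφ : HasDerivWithinAt φ a (Icc 0 1) 0) (hmin : ∀ t ∈ Icc (0 : ℝ) 1, φ 0 ≤ φ t) : 0 ≤ a := by
  have h := hφ.mono Ioo_subset_Icc_self
  rw [hasDerivWithinAt_iff_tendsto_slope' (by simp), nhdsWithin_Ioo_eq_nhdsGT zero_lt_one] at h
  refine ge_of_tendsto h ?_
  filter_upwards [Ioc_mem_nhdsGT (zero_lt_one (α := ℝ))] with t ht
  rw [slope_def_field]
  exact div_nonneg (sub_nonneg.2 (hmin t ⟨ht.1.le, ht.2⟩)) (by linarith [ht.1])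

/-- First order optimality for the composite problem. -/
theorem optimality_of_isMinOn [CompleteSpace E] {K : Set E} {h φ : E → ℝ} {u w d : E}
    (hh : ConvexOn ℝ K h) (hφ : HasGradientWithinAt φ d K w) (hw : w ∈ K)
    (hmin : IsMinOn (fun z => inner ℝ u z + h z + φ z) K w) {z : E} (hz : z ∈ K) :
    inner ℝ u w + h w ≤ inner ℝ u z + h z + inner ℝ d (z - w) := by
  have h1 : HasDerivWithinAt (fun s : ℝ => φ (w + s • (z - w))) (inner ℝ d (z - w))
      (Icc 0 1) 0 := hasDerivWithinAt_line hh.1 hw hz (by simpa using hφ)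
  have h2 := ((hasDerivAt_id (0 : ℝ)).mul_const (inner ℝ u (z - w) + (h z - h w))).hasDerivWithinAt
    (s := Icc (0 : ℝ) 1)
  have h3 := deriv_nonneg_of_isMinOn_left (h2.add h1) fun t ht => ?_
  · rw [inner_sub_right] at h3
    linarith
  have h4 := isMinOn_iff.1 hmin _ (hh.1.add_smul_sub_mem hw hz ht)
  have h5 : h (w + t • (z - w)) ≤ (1 - t) * h w + t * h z := by
    have := hh.2 hw hz (sub_nonneg.2 ht.2) ht.1 (by ring)
    have e : (1 - t) • w + t • z = w + t • (z - w) := by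
      simp only [smul_sub, sub_smul, one_smul]
      abel
    rwa [e] at this
  simp only [inner_add_right, real_inner_smul_right] at h4
  simp
  linarith

theorem exists_isMinOn {K : Set E} {h φ : E → ℝ} (hK : IsCompact K) (hne : K.Nonempty)
    (hh : ContinuousOn h K) (hφ : ContinuousOn φ K) (u : E) :
    ∃ w ∈ K, IsMinOn (fun z => inner ℝ u z + h z + φ z) K w :=
  hK.exists_isMinOn hne (by fun_prop)

/-- The minimizer depends in a Lipschitz manner on the linear term. -/
theorem seminorm_sub_le_of_isMinOn [FiniteDimensional ℝ E] [CompleteSpace E]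
    {p : Seminorm ℝ E} (hp : ∀ x : E, p x = 0 → x = 0)
    {K : Set E} {h φ : E → ℝ} {d : E → E}
    (hh : ConvexOn ℝ K h) (hφ : ∀ x ∈ K, HasGradientWithinAt φ (d x) K x)
    (hd : ∀ x ∈ K, ∀ z ∈ K, p (x - z) ^ 2 ≤ inner ℝ (d x - d z) (x - z))
    {u u' w w' : E} (hw : w ∈ K) (hw' : w' ∈ K)
    (hmin : IsMinOn (fun z => inner ℝ u z + h z + φ z) K w)
    (hmin' : IsMinOn (fun z => inner ℝ u' z + h z + φ z) K w') :
    p (w - w') ≤ dualNorm p (u - u') := by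
  have h1 := optimality_of_isMinOn hh (hφ w hw) hw hmin hw'
  have h2 := optimality_of_isMinOn hh (hφ w' hw') hw' hmin' hw
  have h3 := hd w hw w' hw'
  have h4 := abs_le.1 (abs_inner_le_dualNorm_mul p hp (u - u') (w - w'))
  have h5 : inner ℝ (d w) (w' - w) = - inner ℝ (d w) (w - w') := by
    rw [← neg_sub, inner_neg_right]
  rw [inner_sub_left, inner_sub_right, inner_sub_right] at h4
  rw [inner_sub_left] at h3
  have h6 : p (w - w') * p (w - w') ≤ dualNorm p (u - u') * p (w - w') := by nlinarith
  rcases (apply_nonneg p (w - w')).eq_or_lt with h0 | h0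
  · rw [← h0]; exact dualNorm_nonneg p hp _
  · exact le_of_mul_le_mul_right h6 h0

/-- The minimizer of `⟨u, ·⟩ + h + φ` over `K`. -/
noncomputable def argmin (K : Set E) (h φ : E → ℝ) (u : E) : E :=
  Classical.epsilon fun w => w ∈ K ∧ IsMinOn (fun z => inner ℝ u z + h z + φ z) K w

theorem argmin_spec {K : Set E} {h φ : E → ℝ} (hK : IsCompact K) (hne : K.Nonempty)
    (hh : ContinuousOn h K) (hφ : ContinuousOn φ K) (u : E) :
    argmin K h φ u ∈ K ∧ IsMinOn (fun z => inner ℝ u z + h z + φ z) K (argmin K h φ u) :=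
  Classical.epsilon_spec (p := fun w => w ∈ K ∧ IsMinOn (fun z => inner ℝ u z + h z + φ z) K w)
    (exists_isMinOn hK hne hh hφ u)

/-- Strong convexity makes the minimizer Lipschitz in the linear term. This makes the choice by
`Classical.epsilon` harmless and the iterates measurable. -/
theorem argmin_continuous [FiniteDimensional ℝ E] [CompleteSpace E]
    {p : Seminorm ℝ E} (hp : ∀ x : E, p x = 0 → x = 0)
    {K : Set E} {h φ : E → ℝ} {d : E → E} (hK : IsCompact K) (hne : K.Nonempty)
    (hhc : ContinuousOn h K)
    (hh : ConvexOn ℝ K h) (hφ : ∀ x ∈ K, HasGradientWithinAt φ (d x) K x)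
    (hd : ∀ x ∈ K, ∀ z ∈ K, p (x - z) ^ 2 ≤ inner ℝ (d x - d z) (x - z)) :
    Continuous (argmin K h φ) := by
  obtain ⟨C, hC, hle⟩ := exists_norm_le_mul p hp
  have hφc : ContinuousOn φ K := fun x hx => (hφ x hx).differentiableWithinAt.continuousWithinAt
  rw [continuous_iff_continuousAt]
  intro u
  rw [ContinuousAt, tendsto_iff_norm_sub_tendsto_zero]
  have hlim : Tendsto (fun v => C * dualNorm p (v - u)) (𝓝 u) (𝓝 0) := by
    have hc : Continuous fun v => C * dualNorm p (v - u) := by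
      have := dualNorm_continuous p hp
      fun_prop
    have h0 : dualNorm p (0 : E) = 0 :=
      le_antisymm (dualNorm_le p (by simp)) (dualNorm_nonneg p hp 0)
    simpa [h0] using hc.tendsto u
  refine squeeze_zero (fun _ => norm_nonneg _) (fun v => (hle _).trans ?_) hlim
  have s1 := argmin_spec hK hne hhc hφc v
  have s2 := argmin_spec hK hne hhc hφc u
  exact mul_le_mul_of_nonneg_left
    (seminorm_sub_le_of_isMinOn hp hh hφ hd s1.1 s2.1 s1.2 s2.2) hC.le

end Argmin

/-! ### The local distance-generating function and the prox mapping -/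

section DGF

variable {E : Type*} [NormedAddCommGroup E] [InnerProductSpace ℝ E]

theorem localBall_convex (p : Seminorm ℝ E) {X : Set E} (hX : Convex ℝ X) (x₀ : E) (R : ℝ) :
    Convex ℝ (localBall p X x₀ R) := by
  have : localBall p X x₀ R = X ∩ p.closedBall x₀ R := by
    ext z; simp [localBall, Seminorm.mem_closedBall]
  rw [this]
  exact hX.inter (p.convex_closedBall x₀ R)

theorem localBall_isCompact [FiniteDimensional ℝ E] (p : Seminorm ℝ E)
    (hp : ∀ x : E, p x = 0 → x = 0) {X : Set E} (hX : IsClosed X) (x₀ : E) (R : ℝ) :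
    IsCompact (localBall p X x₀ R) :=
  (isCompact_seminorm_closedBall p hp x₀ R).inter_left hX

theorem mem_localBall_self (p : Seminorm ℝ E) {X : Set E} {x₀ : E} (hx₀ : x₀ ∈ X) {R : ℝ}
    (hR : 0 ≤ R) : x₀ ∈ localBall p X x₀ R := ⟨hx₀, by simpa using hR⟩

theorem seminorm_rescale_le_one (p : Seminorm ℝ E) {X : Set E} {x₀ : E} {R : ℝ} (hR : 0 < R)
    {z : E} (hz : z ∈ localBall p X x₀ R) : p (R⁻¹ • (z - x₀)) ≤ 1 := by
  rw [map_smul_eq_mul, Real.norm_of_nonneg (inv_nonneg.2 hR.le), inv_mul_le_iff₀ hR, mul_one]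
  exact hz.2

variable [CompleteSpace E]

theorem localDGF_hasGradient {p : Seminorm ℝ E} {θ : E → ℝ} {dθ : E → E} (hθ : IsDGF p θ dθ)
    {X : Set E} {x₀ : E} {R : ℝ} (hR : 0 < R) {z : E} (hz : z ∈ localBall p X x₀ R) :
    HasGradientWithinAt (localDGF θ x₀ R) (localDGFGrad dθ x₀ R z) (localBall p X x₀ R) z := by
  rw [hasGradientWithinAt_iff_hasFDerivWithinAt]
  have h1 := hasGradientWithinAt_iff_hasFDerivWithinAt.1
    (hθ.hasGradient _ (seminorm_rescale_le_one p hR hz))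
  have h2 : HasFDerivWithinAt (fun z : E => R⁻¹ • (z - x₀)) (R⁻¹ • ContinuousLinearMap.id ℝ E)
      (localBall p X x₀ R) z := ((hasFDerivWithinAt_id z _).sub_const x₀).const_smul R⁻¹
  have h3 := (h1.comp z h2 fun y hy => seminorm_rescale_le_one p hR hy).const_smul (R ^ 2)
  refine h3.congr_fderiv ?_
  ext v
  simp [localDGFGrad]
  field_simp

theorem localDGF_strong {p : Seminorm ℝ E} {θ : E → ℝ} {dθ : E → E} (hθ : IsDGF p θ dθ)
    {X : Set E} {x₀ : E} {R : ℝ} (hR : 0 < R) : ∀ x ∈ localBall p X x₀ R,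
      ∀ z ∈ localBall p X x₀ R, p (x - z) ^ 2 ≤
        inner ℝ (localDGFGrad dθ x₀ R x - localDGFGrad dθ x₀ R z) (x - z) := by
  intro x hx z hz
  have h := hθ.strong _ _ (seminorm_rescale_le_one p hR hx) (seminorm_rescale_le_one p hR hz)
  rw [← smul_sub, sub_sub_sub_cancel_right, map_smul_eq_mul, real_inner_smul_right,
    Real.norm_of_nonneg (inv_nonneg.2 hR.le), mul_pow] at h
  rw [localDGFGrad, localDGFGrad, ← smul_sub, real_inner_smul_left]
  have := mul_le_mul_of_nonneg_left h (sq_nonneg R)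
  rw [← mul_assoc, ← mul_assoc, ← mul_pow, mul_inv_cancel₀ hR.ne', one_pow, one_mul, sq R,
    mul_assoc R, mul_inv_cancel₀ hR.ne', mul_one] at this
  exact this

theorem localDGFGrad_continuousOn {p : Seminorm ℝ E} {θ : E → ℝ} {dθ : E → E}
    (hθ : IsDGF p θ dθ) {X : Set E} {x₀ : E} {R : ℝ} (hR : 0 < R) :
    ContinuousOn (localDGFGrad dθ x₀ R) (localBall p X x₀ R) := by
  have : ContinuousOn (fun z => dθ (R⁻¹ • (z - x₀))) (localBall p X x₀ R) :=
    hθ.continuousOn.comp (by fun_prop) fun z hz => seminorm_rescale_le_one p hR hz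
  exact this.const_smul R

/-- The origin minimizes `θ` and is interior to the unit ball. Hence the divergence from the center
is just the local d.-g.f., bounded by R²Θ. -/
theorem dgf_grad_zero [FiniteDimensional ℝ E] {p : Seminorm ℝ E} {θ : E → ℝ} {dθ : E → E}
    (hθ : IsDGF p θ dθ) : dθ 0 = 0 := by
  have hnhds : {z : E | p z ≤ 1} ∈ 𝓝 (0 : E) := by
    have : {z : E | p z < 1} ∈ 𝓝 (0 : E) :=
      (isOpen_lt (seminorm_continuous p) continuous_const).mem_nhds (by simp)
    exact mem_of_superset this fun z hz => (show p z < 1 from hz).le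
  have h1 := hasGradientWithinAt_iff_hasFDerivWithinAt.1 (hθ.hasGradient 0 (by simp))
  have h2 := h1.hasFDerivAt hnhds
  have h3 : IsLocalMin θ 0 := by
    filter_upwards [hnhds] with z hz
    rw [hθ.zero]
    exact hθ.nonneg z hz
  have := h3.hasFDerivAt_eq_zero h2
  simpa using this

theorem dgf_continuousOn {p : Seminorm ℝ E} {θ : E → ℝ} {dθ : E → E} (hθ : IsDGF p θ dθ) :
    ContinuousOn θ {z : E | p z ≤ 1} :=
  fun x hx => (hθ.hasGradient x hx).differentiableWithinAt.continuousWithinAt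

theorem le_bigTheta [FiniteDimensional ℝ E] {p : Seminorm ℝ E} (hp : ∀ x : E, p x = 0 → x = 0)
    {θ : E → ℝ} {dθ : E → E} (hθ : IsDGF p θ dθ) {z : E} (hz : p z ≤ 1) :
    θ z ≤ bigTheta p θ := by
  have := isCompact_seminorm_closedBall p hp 0 1
  simp only [sub_zero] at this
  exact le_csSup (this.image_of_continuousOn (dgf_continuousOn hθ)).bddAbove ⟨z, hz, rfl⟩

theorem bigTheta_nonneg [FiniteDimensional ℝ E] {p : Seminorm ℝ E}
    (hp : ∀ x : E, p x = 0 → x = 0) {θ : E → ℝ} {dθ : E → E} (hθ : IsDGF p θ dθ) :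
    0 ≤ bigTheta p θ := by
  have := le_bigTheta hp hθ (z := 0) (by simp)
  rwa [hθ.zero] at this

omit [CompleteSpace E] in
theorem unitBall_convex (p : Seminorm ℝ E) : Convex ℝ {z : E | p z ≤ 1} := by
  have : {z : E | p z ≤ 1} = p.closedBall 0 1 := by
    ext z; simp [Seminorm.mem_closedBall]
  rw [this]
  exact p.convex_closedBall 0 1

/-- Strong convexity from the origin, where `θ` and its gradient vanish, gives θ ≥ 1/2 at a unit
vector. The minibatch estimates use this to absorb terms without a factor Θ. -/
theorem half_le_bigTheta [FiniteDimensional ℝ E] [Nontrivial E] {p : Seminorm ℝ E}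
    (hp : ∀ x : E, p x = 0 → x = 0) {θ : E → ℝ} {dθ : E → E} (hθ : IsDGF p θ dθ) :
    1 / 2 ≤ bigTheta p θ := by
  obtain ⟨v, hv⟩ := exists_ne (0 : E)
  have hv' : 0 < p v := lt_of_le_of_ne (apply_nonneg p v) fun h => hv (hp v h.symm)
  have h1 : p ((p v)⁻¹ • v) = 1 := by
    rw [map_smul_eq_mul, Real.norm_of_nonneg (inv_nonneg.2 hv'.le), inv_mul_cancel₀ hv'.ne']
  have h2 := bregman_lower (p := p) (unitBall_convex p) (f := θ) (d := dθ) (c := 1)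
    hθ.hasGradient (fun x hx z hz => by rw [one_mul]; exact hθ.strong x z hx hz)
    (x := 0) (z := (p v)⁻¹ • v) (by simp) h1.le
  rw [sub_zero, h1, dgf_grad_zero hθ, hθ.zero, inner_zero_left] at h2
  linarith [le_bigTheta hp hθ h1.le]

theorem bregman_center_le [FiniteDimensional ℝ E] {p : Seminorm ℝ E}
    (hp : ∀ x : E, p x = 0 → x = 0) {θ : E → ℝ} {dθ : E → E} (hθ : IsDGF p θ dθ)
    {X : Set E} {x₀ : E} {R : ℝ} (hR : 0 < R) {z : E} (hz : z ∈ localBall p X x₀ R) :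
    bregman θ dθ x₀ R x₀ z ≤ R ^ 2 * bigTheta p θ := by
  have := le_bigTheta hp hθ (seminorm_rescale_le_one p hR hz)
  simp only [bregman, localDGF, localDGFGrad, sub_self, smul_zero, hθ.zero, mul_zero,
    dgf_grad_zero hθ, inner_zero_left, sub_zero]
  gcongr

theorem half_sq_le_bregman {p : Seminorm ℝ E} {θ : E → ℝ} {dθ : E → E} (hθ : IsDGF p θ dθ)
    {X : Set E} (hX : Convex ℝ X) {x₀ : E} {R : ℝ} (hR : 0 < R) {x z : E}
    (hx : x ∈ localBall p X x₀ R) (hz : z ∈ localBall p X x₀ R) :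
    p (z - x) ^ 2 / 2 ≤ bregman θ dθ x₀ R x z := by
  have := bregman_lower (p := p) (localBall_convex p hX x₀ R) (c := 1)
    (fun y hy => localDGF_hasGradient hθ hR hy)
    (fun y hy y' hy' => by rw [one_mul]; exact localDGF_strong hθ hR y hy y' hy') hx hz
  rw [bregman]
  linarith

omit [CompleteSpace E] in
theorem isProx_iff (p : Seminorm ℝ E) (X : Set E) (θ : E → ℝ) (dθ : E → E) (x₀ : E) (R : ℝ)
    (h : E → ℝ) (ζ x w : E) :
    IsProx p X θ dθ x₀ R h ζ x w ↔ w ∈ localBall p X x₀ R ∧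
      IsMinOn (fun z => inner ℝ (ζ - localDGFGrad dθ x₀ R x) z + h z + localDGF θ x₀ R z)
        (localBall p X x₀ R) w := by
  refine and_congr_right fun _ => ?_
  rw [isMinOn_iff, isMinOn_iff]
  refine forall_congr' fun z => imp_congr_right fun _ => ?_
  simp only [bregman, inner_sub_left, inner_sub_right]
  constructor <;> intro h <;> linarith

omit [CompleteSpace E] in
-- The linear part of the divergence is moved into the linear term, so the prox mapping depends on
-- its two arguments only through the single vector `ζ - localDGFGrad dθ x₀ R x`; continuity of
-- `argmin` then gives joint measurability.
theorem prox_eq_argmin (p : Seminorm ℝ E) (X : Set E) (θ : E → ℝ) (dθ : E → E) (x₀ : E) (R : ℝ)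
    (h : E → ℝ) (ζ x : E) :
    prox p X θ dθ x₀ R h ζ x =
      argmin (localBall p X x₀ R) h (localDGF θ x₀ R) (ζ - localDGFGrad dθ x₀ R x) := by
  rw [prox, argmin]
  congr 1
  ext w
  exact isProx_iff p X θ dθ x₀ R h ζ x w

end DGF

/-! ### Exponential supermartingales driven by independent samples -/

section Sampling

variable {Ω S Y : Type*} [MeasurableSpace Ω] [MeasurableSpace S] [MeasurableSpace Y]

/-- Samples with law `P`, each independent of the preceding ones. -/
structure IsSampleSequence (μ : Measure S) (P : Measure Ω) (ξ : ℕ → S → Ω) : Prop where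
  measurePreserving : ∀ i, MeasurePreserving (ξ i) μ P
  indep : ∀ m, Indep (⨆ j ∈ Set.Iio m, MeasurableSpace.comap (ξ j) inferInstance)
    (MeasurableSpace.comap (ξ m) inferInstance) μ

theorem IsIIDSample.isSampleSequence {μ : Measure S} {P : Measure Ω} {ξ : ℕ → S → Ω}
    (h : IsIIDSample μ P ξ) : IsSampleSequence μ P ξ := by
  refine ⟨h.2, fun m => ?_⟩
  have := indep_iSup_of_disjoint (fun i => (h.2 i).measurable.comap_le) h.1
    (S := Set.Iio m) (T := {m}) (by simp)
  simpa using this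

/-- Blocks of an independent array form a sequence of samples of the product law. -/
theorem IsIIDSample.isSampleSequence_block {μ : Measure S} [IsProbabilityMeasure μ]
    {P : Measure Ω} [IsProbabilityMeasure P] {L : ℕ}
    {ξ : ℕ → Fin L → S → Ω} (h : IsIIDSample μ P (fun q : ℕ × Fin L => ξ q.1 q.2)) :
    IsSampleSequence μ (Measure.pi fun _ : Fin L => P) (fun i s l => ξ i l s) := by
  have hm : ∀ i l, Measurable (ξ i l) := fun i l => (h.2 (i, l)).measurable
  refine ⟨fun i => ⟨measurable_pi_lambda _ (hm i), ?_⟩, fun m => ?_⟩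
  · have h1 : iIndepFun (fun l => ξ i l) μ :=
      h.1.precomp (g := fun l : Fin L => (i, l)) fun _ _ hab => (Prod.mk.inj hab).2
    rw [h1.map_fun_eq_pi_map fun l => (hm i l).aemeasurable]
    congr 1
    ext l : 1
    exact (h.2 (i, l)).map_eq
  · have h1 := indep_iSup_of_disjoint (fun q => (h.2 q).measurable.comap_le) h.1
      (S := {q | q.1 < m}) (T := {q | q.1 = m})
      (Set.disjoint_left.2 fun q (hq : q.1 < m) (hq' : q.1 = m) => hq.ne hq')
    have hle : ∀ i : ℕ, ∀ T : Set (ℕ × Fin L), (∀ l, (i, l) ∈ T) →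
        MeasurableSpace.comap (fun s l => ξ i l s) inferInstance ≤
          ⨆ q ∈ T, MeasurableSpace.comap (ξ q.1 q.2) inferInstance := fun i T hT => by
      refine Measurable.comap_le (@measurable_pi_lambda _ _ _ (_) _ _ fun l => ?_)
      refine Measurable.mono (comap_measurable (ξ i l)) ?_ le_rfl
      exact le_iSup₂_of_le (i, l) (hT l) le_rfl
    refine indep_of_indep_of_le_left (indep_of_indep_of_le_right h1 ?_) ?_
    · exact hle m _ fun l => rfl
    · exact iSup₂_le fun j hj => hle j _ fun l => hj

omit [MeasurableSpace S] in
theorem measurable_pair {m : MeasurableSpace S} {Z : Type*} [MeasurableSpace Z] {f : S → Y}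
    {g : S → Z} (hf : Measurable[m] f) (hg : Measurable[m] g) :
    Measurable[m] fun s => (f s, g s) := hf.prodMk hg

omit [MeasurableSpace S] in
theorem measurable_mul_ennreal {m : MeasurableSpace S} {f g : S → ℝ≥0∞} (hf : Measurable[m] f)
    (hg : Measurable[m] g) : Measurable[m] fun s => f s * g s := hf.mul hg

/-- The supermartingale property without conditional expectations: the state and the product of past
factors are functions of earlier samples, hence jointly independent of the next one, which Tonelli
integrates out first. -/
theorem lintegral_prod_process_le_one {μ : Measure S} [IsProbabilityMeasure μ]
    {P : Measure Ω} [IsProbabilityMeasure P] {ξ : ℕ → S → Ω} (hξ : IsSampleSequence μ P ξ)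
    {step : Y → Ω → Y} (hstep : Measurable (Function.uncurry step))
    {y : ℕ → S → Y} {y₀ : Y} (h0 : ∀ s, y 0 s = y₀) (hy : ∀ i s, y (i + 1) s = step (y i s) (ξ i s))
    {f : Y → Ω → ℝ≥0∞} (hf : Measurable (Function.uncurry f))
    (hint : ∀ y, ∫⁻ ω, f y ω ∂P ≤ 1) (m : ℕ) :
    Measurable (fun s => ∏ i ∈ Finset.range m, f (y i s) (ξ i s)) ∧
      ∫⁻ s, ∏ i ∈ Finset.range m, f (y i s) (ξ i s) ∂μ ≤ 1 := by
  let F : ℕ → MeasurableSpace S := fun m =>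
    ⨆ j ∈ Set.Iio m, MeasurableSpace.comap (ξ j) inferInstance
  have hFle : ∀ m, F m ≤ (inferInstance : MeasurableSpace S) := fun m =>
    iSup₂_le fun j _ => (hξ.measurePreserving j).measurable.comap_le
  have hFmono : ∀ m, F m ≤ F (m + 1) := fun m =>
    biSup_mono fun j (hj : j < m) => hj.trans (Nat.lt_succ_self m)
  have hξm : ∀ m, Measurable[F (m + 1)] (ξ m) := fun m =>
    Measurable.mono (comap_measurable (ξ m))
      (le_iSup₂_of_le m (Nat.lt_succ_self m) le_rfl) le_rfl
  have hym : ∀ m, Measurable[F m] (y m) := fun m => by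
    induction m with
    | zero =>
      rw [show y 0 = fun _ => y₀ from funext h0]
      exact @measurable_const _ _ _ (F 0) _
    | succ m ih =>
      rw [show y (m + 1) = fun s => Function.uncurry step (y m s, ξ m s) from funext (hy m)]
      exact hstep.comp (measurable_pair (m := F (m + 1))
        (Measurable.mono ih (hFmono m) le_rfl) (hξm m))
  have hprod : ∀ m, Measurable[F m] (fun s => ∏ i ∈ Finset.range m, f (y i s) (ξ i s)) :=
    fun m => by
    induction m with
    | zero => simp only [Finset.range_zero, Finset.prod_empty]; exact @measurable_const _ _ _ (F 0) _
    | succ m ih =>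
      simp only [Finset.prod_range_succ]
      refine measurable_mul_ennreal (m := F (m + 1)) (Measurable.mono ih (hFmono m) le_rfl) ?_
      exact hf.comp (measurable_pair (m := F (m + 1))
        (Measurable.mono (hym m) (hFmono m) le_rfl) (hξm m))
  refine ⟨Measurable.mono (hprod m) (hFle m) le_rfl, ?_⟩
  induction m with
  | zero => simp
  | succ m ih =>
    -- State and accumulated product must be handled as one pair: independence of the new sample
    -- from each of them separately would not give the product law.
    have hpair : Measurable[F m] (fun s => (y m s, ∏ i ∈ Finset.range m, f (y i s) (ξ i s))) :=
      measurable_pair (m := F m) (hym m) (hprod m)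
    have hpair' := Measurable.mono hpair (hFle m) le_rfl
    have hind : IndepFun (fun s => (y m s, ∏ i ∈ Finset.range m, f (y i s) (ξ i s))) (ξ m) μ :=
      indep_of_indep_of_le_left (hξ.indep m) hpair.comap_le
    have hξm' := (hξ.measurePreserving m).measurable
    have hmap := (indepFun_iff_map_prod_eq_prod_map_map hpair'.aemeasurable
      hξm'.aemeasurable).1 hind
    rw [(hξ.measurePreserving m).map_eq] at hmap
    have hF : Measurable (fun q : (Y × ℝ≥0∞) × Ω => q.1.2 * Function.uncurry f (q.1.1, q.2)) :=
      measurable_fst.snd.mul (hf.comp (measurable_fst.fst.prodMk measurable_snd))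
    calc ∫⁻ s, ∏ i ∈ Finset.range (m + 1), f (y i s) (ξ i s) ∂μ
        = ∫⁻ s, (fun q : (Y × ℝ≥0∞) × Ω => q.1.2 * Function.uncurry f (q.1.1, q.2))
            ((y m s, ∏ i ∈ Finset.range m, f (y i s) (ξ i s)), ξ m s) ∂μ := by
          simp only [Finset.prod_range_succ, Function.uncurry]
      _ = ∫⁻ q : (Y × ℝ≥0∞) × Ω, q.1.2 * Function.uncurry f (q.1.1, q.2)
            ∂((μ.map fun s => (y m s, ∏ i ∈ Finset.range m, f (y i s) (ξ i s))).prod P) := by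
          rw [← hmap, lintegral_map hF (hpair'.prodMk hξm')]
      _ = ∫⁻ r : Y × ℝ≥0∞, ∫⁻ ω, r.2 * f r.1 ω ∂P
            ∂(μ.map fun s => (y m s, ∏ i ∈ Finset.range m, f (y i s) (ξ i s))) := by
          rw [lintegral_prod _ hF.aemeasurable]; rfl
      _ ≤ ∫⁻ r : Y × ℝ≥0∞, r.2
            ∂(μ.map fun s => (y m s, ∏ i ∈ Finset.range m, f (y i s) (ξ i s))) := by
          refine lintegral_mono fun r => ?_
          have hr : Measurable fun ω => f r.1 ω := hf.comp measurable_prodMk_left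
          rw [lintegral_const_mul _ hr]
          exact mul_le_of_le_one_right' (hint r.1)
      _ = ∫⁻ s, ∏ i ∈ Finset.range m, f (y i s) (ξ i s) ∂μ := by
          rw [lintegral_map measurable_snd hpair']
      _ ≤ 1 := ih

/-- Exponential Markov inequality along a process. -/
theorem process_tail {μ : Measure S} [IsProbabilityMeasure μ]
    {P : Measure Ω} [IsProbabilityMeasure P] {ξ : ℕ → S → Ω} (hξ : IsSampleSequence μ P ξ)
    {step : Y → Ω → Y} (hstep : Measurable (Function.uncurry step))
    {y : ℕ → S → Y} {y₀ : Y} (h0 : ∀ s, y 0 s = y₀) (hy : ∀ i s, y (i + 1) s = step (y i s) (ξ i s))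
    {A : Y → Ω → ℝ} (hA : Measurable (Function.uncurry A))
    (hint : ∀ y, ∫⁻ ω, ENNReal.ofReal (Real.exp (A y ω)) ∂P ≤ 1) (m : ℕ) (t : ℝ) :
    ENNReal.ofReal (1 - Real.exp (-t)) ≤
      μ {s | ∑ i ∈ Finset.range m, A (y i s) (ξ i s) ≤ t} := by
  obtain ⟨hm, hle⟩ := lintegral_prod_process_le_one hξ hstep h0 hy
    (f := fun y ω => ENNReal.ofReal (Real.exp (A y ω)))
    (ENNReal.measurable_ofReal.comp (Real.measurable_exp.comp hA)) hint m
  have heq : ∀ s, ∏ i ∈ Finset.range m, ENNReal.ofReal (Real.exp (A (y i s) (ξ i s))) =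
      ENNReal.ofReal (Real.exp (∑ i ∈ Finset.range m, A (y i s) (ξ i s))) := fun s => by
    rw [Real.exp_sum, ENNReal.ofReal_prod_of_nonneg fun _ _ => (Real.exp_pos _).le]
  simp only [heq] at hm hle
  set Z : S → ℝ := fun s => ∑ i ∈ Finset.range m, A (y i s) (ξ i s)
  let B := {s | ENNReal.ofReal (Real.exp t) ≤ ENNReal.ofReal (Real.exp (Z s))}
  have hB : MeasurableSet B := measurableSet_le measurable_const hm
  have h1 : μ B ≤ ENNReal.ofReal (Real.exp (-t)) := by
    have := (mul_meas_ge_le_lintegral hm (ENNReal.ofReal (Real.exp t))).trans hle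
    rw [Real.exp_neg, ENNReal.ofReal_inv_of_pos (Real.exp_pos t)]
    rw [ENNReal.le_inv_iff_mul_le, mul_comm]
    exact this
  have hsub : Bᶜ ⊆ {s | Z s ≤ t} := fun s hs => by
    have : ¬ ENNReal.ofReal (Real.exp t) ≤ ENNReal.ofReal (Real.exp (Z s)) := hs
    rw [ENNReal.ofReal_le_ofReal_iff (Real.exp_pos _).le, Real.exp_le_exp] at this
    exact (not_le.1 this).le
  refine le_trans ?_ (measure_mono hsub)
  rw [prob_compl_eq_one_sub hB, ENNReal.ofReal_sub _ (Real.exp_pos _).le, ENNReal.ofReal_one]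
  exact tsub_le_tsub_left h1 _

end Sampling

/-! ### One-step exponential moment bounds -/

section ExpMoments

variable {Ω : Type*} [MeasurableSpace Ω] {P : Measure Ω} [IsProbabilityMeasure P]

/-- The first-order term is exactly `x`, so for a centered variable only exp(x²) survives
integration. -/
theorem exp_le_add_exp_sq (x : ℝ) : Real.exp x ≤ x + Real.exp (x ^ 2) := by
  have h2 : x ^ 2 + 1 ≤ Real.exp (x ^ 2) := Real.add_one_le_exp _
  rcases le_or_gt |x| 1 with h | h
  · have h1 := abs_le.1 (Real.abs_exp_sub_one_sub_id_le h)
    linarith [h1.2]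
  · rcases lt_abs.1 h with h | h
    · have : Real.exp x ≤ Real.exp (x ^ 2) := Real.exp_le_exp.2 (by nlinarith)
      linarith
    · have : Real.exp x ≤ 1 := Real.exp_le_one_iff.2 (by linarith)
      nlinarith

theorem exp_convex_comb {a b s : ℝ} (h0 : 0 ≤ s) (h1 : s ≤ 1) :
    Real.exp (s * a + (1 - s) * b) ≤ s * Real.exp a + (1 - s) * Real.exp b := by
  have := convexOn_exp.2 (mem_univ a) (mem_univ b) h0 (sub_nonneg.2 h1) (by ring)
  simpa using this

/-- The exponential moment bound `𝔼 exp X ≤ 1` passes to multiples `s X`, `0 ≤ s ≤ 1`. -/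
theorem lintegral_exp_mul_le_one {X : Ω → ℝ}
    (h : ∫⁻ ω, ENNReal.ofReal (Real.exp (X ω)) ∂P ≤ 1) {s : ℝ} (h0 : 0 ≤ s) (h1 : s ≤ 1) :
    ∫⁻ ω, ENNReal.ofReal (Real.exp (s * X ω)) ∂P ≤ 1 := by
  calc ∫⁻ ω, ENNReal.ofReal (Real.exp (s * X ω)) ∂P
      ≤ ∫⁻ ω, (ENNReal.ofReal s * ENNReal.ofReal (Real.exp (X ω)) + ENNReal.ofReal (1 - s)) ∂P := by
        refine lintegral_mono fun ω => ?_
        rw [← ENNReal.ofReal_mul h0, ← ENNReal.ofReal_add (by positivity) (by linarith)]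
        refine ENNReal.ofReal_le_ofReal ?_
        simpa using exp_convex_comb (a := X ω) (b := 0) h0 h1
    _ = ENNReal.ofReal s * ∫⁻ ω, ENNReal.ofReal (Real.exp (X ω)) ∂P + ENNReal.ofReal (1 - s) := by
        rw [lintegral_add_right _ measurable_const, lintegral_const_mul' _ _ ENNReal.ofReal_ne_top]
        simp
    _ ≤ ENNReal.ofReal s * 1 + ENNReal.ofReal (1 - s) := by gcongr
    _ = 1 := by
        rw [mul_one, ← ENNReal.ofReal_add h0 (by linarith)]
        simp

omit [IsProbabilityMeasure P] in
/-- The bound `𝔼 exp X ≤ 1` passes to convex combinations. -/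
theorem lintegral_exp_comb_le_one {X Y : Ω → ℝ} (hX : Measurable X)
    (h : ∫⁻ ω, ENNReal.ofReal (Real.exp (X ω)) ∂P ≤ 1)
    (h' : ∫⁻ ω, ENNReal.ofReal (Real.exp (Y ω)) ∂P ≤ 1) {s : ℝ} (h0 : 0 ≤ s) (h1 : s ≤ 1) :
    ∫⁻ ω, ENNReal.ofReal (Real.exp (s * X ω + (1 - s) * Y ω)) ∂P ≤ 1 := by
  have h1' : 0 ≤ 1 - s := by linarith
  calc ∫⁻ ω, ENNReal.ofReal (Real.exp (s * X ω + (1 - s) * Y ω)) ∂P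
      ≤ ∫⁻ ω, (ENNReal.ofReal s * ENNReal.ofReal (Real.exp (X ω)) +
          ENNReal.ofReal (1 - s) * ENNReal.ofReal (Real.exp (Y ω))) ∂P := by
        refine lintegral_mono fun ω => ?_
        rw [← ENNReal.ofReal_mul h0, ← ENNReal.ofReal_mul h1',
          ← ENNReal.ofReal_add (by positivity) (by positivity)]
        exact ENNReal.ofReal_le_ofReal (exp_convex_comb h0 h1)
    _ = ENNReal.ofReal s * ∫⁻ ω, ENNReal.ofReal (Real.exp (X ω)) ∂P +
          ENNReal.ofReal (1 - s) * ∫⁻ ω, ENNReal.ofReal (Real.exp (Y ω)) ∂P := by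
        rw [lintegral_add_left (by fun_prop), lintegral_const_mul' _ _ ENNReal.ofReal_ne_top,
          lintegral_const_mul' _ _ ENNReal.ofReal_ne_top]
    _ ≤ ENNReal.ofReal s * 1 + ENNReal.ofReal (1 - s) * 1 := by gcongr
    _ = 1 := by
        rw [mul_one, mul_one, ← ENNReal.ofReal_add h0 h1']
        simp

/-- A centered variable dominated by a sub-Gaussian one is sub-Gaussian. -/
theorem lintegral_exp_centered_le_one {Z U : Ω → ℝ} (hZ : Integrable Z P) (h0 : ∫ ω, Z ω ∂P = 0)
    (hUm : Measurable U) (hZU : ∀ ω, |Z ω| ≤ U ω)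
    (hU : ∫⁻ ω, ENNReal.ofReal (Real.exp (U ω ^ 2 - 1)) ∂P ≤ 1) (l : ℝ) :
    ∫⁻ ω, ENNReal.ofReal (Real.exp (l * Z ω - l ^ 2)) ∂P ≤ 1 := by
  have hsq : ∀ ω, Z ω ^ 2 ≤ U ω ^ 2 := fun ω => by
    rw [← sq_abs]
    exact pow_le_pow_left₀ (abs_nonneg _) (hZU ω) 2
  -- For small `l` the linear term of `exp_le_add_exp_sq` integrates to zero, and the power l² ≤ 1
  -- of the hypothesis suffices. For large `l`, lZ ≤ (l² + Z²)/2 leaves at most (U² - 1)/2, and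
  -- centering is not needed.
  rcases le_or_gt (l ^ 2) 1 with hl | hl
  · have h1 := lintegral_exp_mul_le_one hU (sq_nonneg l) hl
    have hm : Measurable fun ω => Real.exp (l ^ 2 * (U ω ^ 2 - 1)) := by fun_prop
    have hint : Integrable (fun ω => Real.exp (l ^ 2 * (U ω ^ 2 - 1))) P := by
      refine ⟨hm.aestronglyMeasurable, ?_⟩
      rw [hasFiniteIntegral_iff_ofReal (Eventually.of_forall fun _ => (Real.exp_pos _).le)]
      exact h1.trans_lt ENNReal.one_lt_top
    have hint2 : Integrable (fun ω => Real.exp (-l ^ 2) * (l * Z ω) +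
        Real.exp (l ^ 2 * (U ω ^ 2 - 1))) P := ((hZ.const_mul l).const_mul _).add hint
    have hpt : ∀ ω, Real.exp (l * Z ω - l ^ 2) ≤
        Real.exp (-l ^ 2) * (l * Z ω) + Real.exp (l ^ 2 * (U ω ^ 2 - 1)) := fun ω => by
      have e1 := exp_le_add_exp_sq (l * Z ω)
      have e2 : Real.exp ((l * Z ω) ^ 2) ≤ Real.exp (l ^ 2 * U ω ^ 2) := by
        rw [mul_pow]
        exact Real.exp_le_exp.2 (mul_le_mul_of_nonneg_left (hsq ω) (sq_nonneg l))
      have e3 : Real.exp (l ^ 2 * (U ω ^ 2 - 1)) = Real.exp (-l ^ 2) * Real.exp (l ^ 2 * U ω ^ 2) := by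
        rw [← Real.exp_add]; ring_nf
      rw [sub_eq_neg_add, Real.exp_add, e3, ← mul_add]
      exact mul_le_mul_of_nonneg_left (by linarith) (Real.exp_pos _).le
    calc ∫⁻ ω, ENNReal.ofReal (Real.exp (l * Z ω - l ^ 2)) ∂P
        ≤ ∫⁻ ω, ENNReal.ofReal (Real.exp (-l ^ 2) * (l * Z ω) +
            Real.exp (l ^ 2 * (U ω ^ 2 - 1))) ∂P :=
          lintegral_mono fun ω => ENNReal.ofReal_le_ofReal (hpt ω)
      _ = ENNReal.ofReal (∫ ω, (Real.exp (-l ^ 2) * (l * Z ω) +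
            Real.exp (l ^ 2 * (U ω ^ 2 - 1))) ∂P) :=
          (ofReal_integral_eq_lintegral_ofReal hint2
            (Eventually.of_forall fun ω => (Real.exp_pos _).le.trans (hpt ω))).symm
      _ = ENNReal.ofReal (∫ ω, Real.exp (l ^ 2 * (U ω ^ 2 - 1)) ∂P) := by
          rw [integral_add ((hZ.const_mul l).const_mul _) hint, integral_const_mul,
            integral_const_mul, h0]
          simp
      _ = ∫⁻ ω, ENNReal.ofReal (Real.exp (l ^ 2 * (U ω ^ 2 - 1))) ∂P :=
          ofReal_integral_eq_lintegral_ofReal hint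
            (Eventually.of_forall fun _ => (Real.exp_pos _).le)
      _ ≤ 1 := h1
  · have h1 := lintegral_exp_mul_le_one hU (s := 1 / 2) (by norm_num) (by norm_num)
    refine (lintegral_mono fun ω => ENNReal.ofReal_le_ofReal (Real.exp_le_exp.2 ?_)).trans h1
    nlinarith [hsq ω, sq_nonneg (l - Z ω)]

/-- Lower tail of a `[0, 1]`-valued variable. -/
theorem lintegral_exp_lower_le_one {q : Ω → ℝ} (hq : Measurable q) (hq0 : ∀ᵐ ω ∂P, 0 ≤ q ω)
    (hq1 : ∀ᵐ ω ∂P, q ω ≤ 1) :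
    ∫⁻ ω, ENNReal.ofReal (Real.exp (1 / 2 * (3 / 4 * ∫ ω', q ω' ∂P - q ω))) ∂P ≤ 1 := by
  have hint : Integrable q P := by
    refine Integrable.of_bound hq.aestronglyMeasurable 1 ?_
    filter_upwards [hq0, hq1] with ω h0 h1
    rwa [Real.norm_of_nonneg h0]
  set Q := ∫ ω', q ω' ∂P with hQ
  have hint2 : Integrable (fun ω => Real.exp (3 / 8 * Q) * (1 - 3 / 8 * q ω)) P :=
    ((integrable_const 1).sub (hint.const_mul _)).const_mul _
  have hpt : ∀ᵐ ω ∂P, Real.exp (1 / 2 * (3 / 4 * Q - q ω)) ≤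
      Real.exp (3 / 8 * Q) * (1 - 3 / 8 * q ω) := by
    filter_upwards [hq0, hq1] with ω h0 h1
    -- The chord of exp(-q/2) over [0, 1], with exp(-1/2) ≤ 5/8. The slope 3/8 is the exponent 1/2
    -- times the retained fraction 3/4 of the mean.
    have e1 : Real.exp (-(q ω / 2)) ≤ 1 - 3 / 8 * q ω := by
      have h2 := exp_convex_comb (a := -(1 / 2)) (b := 0) h0 h1
      have h3 : Real.exp (-(1 / 2)) ≤ 5 / 8 := by
        have h4 : Real.exp (-(1 / 2)) ^ 2 = Real.exp (-1) := by
          rw [← Real.exp_nat_mul]; norm_num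
        nlinarith [Real.exp_neg_one_lt_d9, Real.exp_pos (-(1 / 2))]
      rw [Real.exp_zero] at h2
      have h5 : q ω * -(1 / 2) + (1 - q ω) * 0 = -(q ω / 2) := by ring
      rw [h5] at h2
      nlinarith
    have e2 : 1 / 2 * (3 / 4 * Q - q ω) = 3 / 8 * Q + -(q ω / 2) := by ring
    rw [e2, Real.exp_add]
    exact mul_le_mul_of_nonneg_left e1 (Real.exp_pos _).le
  calc ∫⁻ ω, ENNReal.ofReal (Real.exp (1 / 2 * (3 / 4 * Q - q ω))) ∂P
      ≤ ∫⁻ ω, ENNReal.ofReal (Real.exp (3 / 8 * Q) * (1 - 3 / 8 * q ω)) ∂P :=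
        lintegral_mono_ae (hpt.mono fun ω h => ENNReal.ofReal_le_ofReal h)
    _ = ENNReal.ofReal (∫ ω, Real.exp (3 / 8 * Q) * (1 - 3 / 8 * q ω) ∂P) :=
        (ofReal_integral_eq_lintegral_ofReal hint2
          (hpt.mono fun ω h => (Real.exp_pos _).le.trans h)).symm
    _ = ENNReal.ofReal (Real.exp (3 / 8 * Q) * (1 - 3 / 8 * Q)) := by
        rw [integral_const_mul, integral_sub (integrable_const 1) (hint.const_mul _),
          integral_const_mul]
        simp [hQ]
    _ ≤ 1 := by
        rw [← ENNReal.ofReal_one]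
        refine ENNReal.ofReal_le_ofReal ?_
        have h1 := Real.add_one_le_exp (-(3 / 8 * Q))
        calc Real.exp (3 / 8 * Q) * (1 - 3 / 8 * Q)
            ≤ Real.exp (3 / 8 * Q) * Real.exp (-(3 / 8 * Q)) :=
              mul_le_mul_of_nonneg_left (by linarith) (Real.exp_pos _).le
          _ = 1 := by rw [← Real.exp_add, add_neg_cancel, Real.exp_zero]

omit [IsProbabilityMeasure P] in
theorem IsSubGaussian.lintegral_le_one {E : Type*} [NormedAddCommGroup E] [InnerProductSpace ℝ E]
    {p : Seminorm ℝ E} {ξ : Ω → E} {σ : ℝ} (h : IsSubGaussian p P ξ σ) :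
    ∫⁻ ω, ENNReal.ofReal (Real.exp ((dualNorm p (ξ ω) / σ) ^ 2 - 1)) ∂P ≤ 1 := by
  have e : ∀ ω, ENNReal.ofReal (Real.exp ((dualNorm p (ξ ω) / σ) ^ 2 - 1)) =
      ENNReal.ofReal (Real.exp (-1)) *
        ENNReal.ofReal (Real.exp (dualNorm p (ξ ω) ^ 2 / σ ^ 2)) := fun ω => by
    rw [← ENNReal.ofReal_mul (Real.exp_pos _).le, ← Real.exp_add, div_pow]
    ring_nf
  simp only [e]
  rw [lintegral_const_mul' _ _ ENNReal.ofReal_ne_top]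
  calc _ ≤ ENNReal.ofReal (Real.exp (-1)) * ENNReal.ofReal (Real.exp 1) := by gcongr; exact h
    _ = 1 := by
      rw [← ENNReal.ofReal_mul (Real.exp_pos _).le, ← Real.exp_add]
      simp

end ExpMoments

/-! ### The deterministic one-step inequality and averaging -/

section Deterministic

variable {E : Type*} [NormedAddCommGroup E] [InnerProductSpace ℝ E] [FiniteDimensional ℝ E]
  [CompleteSpace E]

theorem prox_spec {p : Seminorm ℝ E} (hp : ∀ x : E, p x = 0 → x = 0) {θ : E → ℝ} {dθ : E → E}
    (hθ : IsDGF p θ dθ) {X : Set E} (hX : IsClosed X) {x₀ : E} (hx₀ : x₀ ∈ X)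
    {R : ℝ} (hR : 0 < R) {h : E → ℝ} (hh : Continuous h) (ζ x : E) :
    IsProx p X θ dθ x₀ R h ζ x (prox p X θ dθ x₀ R h ζ x) := by
  rw [isProx_iff, prox_eq_argmin]
  exact argmin_spec (localBall_isCompact p hp hX x₀ R) ⟨x₀, mem_localBall_self p hx₀ hR.le⟩
    hh.continuousOn
    (fun y hy => (localDGF_hasGradient hθ hR hy).differentiableWithinAt.continuousWithinAt) _

omit [FiniteDimensional ℝ E] in
theorem three_point {p : Seminorm ℝ E} {θ : E → ℝ} {dθ : E → E}
    (hθ : IsDGF p θ dθ) {X : Set E} (hXc : Convex ℝ X) {x₀ : E}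
    {R : ℝ} (hR : 0 < R) {h : E → ℝ} (hh : ConvexOn ℝ univ h) {ζ x w : E}
    (hw : IsProx p X θ dθ x₀ R h ζ x w) {z : E} (hz : z ∈ localBall p X x₀ R) :
    inner ℝ ζ (w - z) + (h w - h z) ≤
      bregman θ dθ x₀ R x z - bregman θ dθ x₀ R w z - bregman θ dθ x₀ R x w := by
  rw [isProx_iff] at hw
  have h1 := optimality_of_isMinOn (hh.subset (subset_univ _) (localBall_convex p hXc x₀ R))
    (localDGF_hasGradient hθ hR hw.1) hw.1 hw.2 hz
  simp only [bregman, inner_sub_left, inner_sub_right] at h1 ⊢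
  linarith

theorem le_add_of_sq_le {a b c : ℝ} (hb : 0 ≤ b) (hc : 0 ≤ c) (h : a ^ 2 ≤ 4 * b * c) :
    a ≤ b + c := by
  refine le_of_abs_le (abs_le_of_sq_le_sq ?_ (add_nonneg hb hc))
  nlinarith [sq_nonneg (b - c)]

omit [FiniteDimensional ℝ E] in
/-- One step of composite mirror descent, with the observation split as `a + b`. -/
theorem step_bound {p : Seminorm ℝ E} {θ : E → ℝ} {dθ : E → E}
    (hθ : IsDGF p θ dθ) {X : Set E} (hXc : Convex ℝ X) {x₀ : E}
    {R : ℝ} (hR : 0 < R) {κ γ ν : ℝ} (hκ : 0 ≤ κ) (hγ : 0 < γ) (hν : 0 < ν)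
    (hγν : γ * ν ≤ 1 / 4) {a b y w z : E}
    (hw : IsProx p X θ dθ x₀ R (fun v => γ * (κ * p v)) (γ • (a + b)) y w)
    (hy : y ∈ localBall p X x₀ R) (hz : z ∈ localBall p X x₀ R) {s : ℝ}
    (hq : 0 ≤ inner ℝ a (y - z))
    (ha : inner ℝ a (y - w) ^ 2 ≤ ν * p (y - w) ^ 2 * inner ℝ a (y - z))
    (hb : inner ℝ b (y - w) ≤ s * p (y - w)) :
    3 / 4 * (γ * inner ℝ a (y - z)) + γ * κ * (p w - p z) ≤
      bregman θ dθ x₀ R y z - bregman θ dθ x₀ R w z + γ ^ 2 * s ^ 2 - γ * inner ℝ b (y - z) := by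
  have hconv : ConvexOn ℝ univ (fun v => γ * (κ * p v)) := (p.convexOn.smul hκ).smul hγ.le
  have h1 := three_point hθ hXc hR hconv hw hz
  have h2 := half_sq_le_bregman hθ hXc hR hy hw.1
  rw [← map_neg_eq_map, neg_sub] at h2
  set r := p (y - w)
  set q := inner ℝ a (y - z)
  -- The r²/2 provided by the divergence is shared equally: r²/4 here through cocoercivity, r²/4 in
  -- `h4` for the noise at the solution.
  have h3 : γ * inner ℝ a (y - w) ≤ γ ^ 2 * ν * q + r ^ 2 / 4 := by
    refine le_add_of_sq_le (by positivity) (by positivity) ?_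
    have := mul_le_mul_of_nonneg_left ha (sq_nonneg γ)
    nlinarith
  have h4 : γ * inner ℝ b (y - w) ≤ γ ^ 2 * s ^ 2 + r ^ 2 / 4 := by
    have := mul_le_mul_of_nonneg_left hb hγ.le
    nlinarith [sq_nonneg (γ * s - r / 2)]
  have h5 : inner ℝ (γ • (a + b)) (w - z) = γ * q + γ * inner ℝ b (y - z)
      - γ * inner ℝ a (y - w) - γ * inner ℝ b (y - w) := by
    have : w - z = (y - z) - (y - w) := by abel
    rw [this, real_inner_smul_left, inner_add_left, inner_sub_right a, inner_sub_right b]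
    ring
  have h6 : γ ^ 2 * ν * q ≤ 1 / 4 * (γ * q) := by
    have := mul_le_mul_of_nonneg_right hγν (mul_nonneg hγ.le hq)
    nlinarith
  rw [h5] at h1
  linarith

variable [MeasurableSpace E] {Ω : Type*} [MeasurableSpace Ω] {P : Measure Ω}

omit [FiniteDimensional ℝ E] in
theorem gradient_monotone {p : Seminorm ℝ E} {X : Set E} {G : E → Ω → ℝ} {dG : E → Ω → E}
    {dg : E → E} {lip : Ω → ℝ} {ν : ℝ} (h : IsProblem p X P G dG dg lip ν) (ω : Ω) {y z : E}
    (hy : y ∈ X) (hz : z ∈ X) : 0 ≤ inner ℝ (dG y ω - dG z ω) (y - z) := by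
  have h1 := inner_gradient_le (h.convexOn ω) hy hz (h.hasGradient ω y hy)
  have h2 := inner_gradient_le (h.convexOn ω) hz hy (h.hasGradient ω z hz)
  rw [← neg_sub, inner_neg_right] at h1
  rw [inner_sub_left]
  linarith

omit [FiniteDimensional ℝ E] in
theorem compositeObjective_convexOn {p : Seminorm ℝ E} {X : Set E} {G : E → Ω → ℝ}
    {dG : E → Ω → E} {dg : E → E} {lip : Ω → ℝ} {ν : ℝ} (h : IsProblem p X P G dG dg lip ν)
    {κ : ℝ} (hκ : 0 ≤ κ) : ConvexOn ℝ X (compositeObjective P G p κ) :=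
  (h.mean_convexOn.smul (by norm_num : (0 : ℝ) ≤ 1 / 2)).add
    ((p.convexOn.subset (subset_univ _) h.convex).smul hκ)

omit [FiniteDimensional ℝ E] [CompleteSpace E] [MeasurableSpace E] in
theorem approxSol_eq_sum {X : Set E} {p : Seminorm ℝ E}
    {θ : E → ℝ} {dθ : E → E} {x₀ : E} {R : ℝ} {φ : E → ℝ} {γ : ℝ}
    (hγ : 0 < γ) {H : ℕ → E → E} {m : ℕ} (hm : 1 ≤ m) :
    approxSol p X θ dθ x₀ R φ (fun _ => γ) H m =
      ∑ i ∈ Finset.range m, (m : ℝ)⁻¹ • iter p X θ dθ x₀ R φ (fun _ => γ) H i := by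
  have hm0 : (0 : ℝ) < m := by exact_mod_cast hm
  rw [approxSol, ← Finset.smul_sum, ← Finset.smul_sum, smul_smul]
  congr 1
  simp
  field_simp

omit [FiniteDimensional ℝ E] [CompleteSpace E] [MeasurableSpace E] in
theorem approxSol_mem {X : Set E} (hX : Convex ℝ X) {p : Seminorm ℝ E}
    {θ : E → ℝ} {dθ : E → E} {x₀ : E} {R : ℝ} {φ : E → ℝ} {γ : ℝ}
    (hγ : 0 < γ) {H : ℕ → E → E} {m : ℕ} (hm : 1 ≤ m)
    (hmem : ∀ i, iter p X θ dθ x₀ R φ (fun _ => γ) H i ∈ X) :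
    approxSol p X θ dθ x₀ R φ (fun _ => γ) H m ∈ X := by
  have hm0 : (0 : ℝ) < m := by exact_mod_cast hm
  rw [approxSol_eq_sum hγ hm]
  exact hX.sum_mem (fun _ _ => by positivity) (by simp [hm0.ne']) fun i _ => hmem i

omit [FiniteDimensional ℝ E] in
theorem approxSol_gap_le {p : Seminorm ℝ E} {X : Set E} {G : E → Ω → ℝ}
    {dG : E → Ω → E} {dg : E → E} {lip : Ω → ℝ} {ν : ℝ} (h : IsProblem p X P G dG dg lip ν)
    {κ : ℝ} (hκ : 0 ≤ κ) {θ : E → ℝ} {dθ : E → E} {x₀ : E} {R : ℝ} {φ : E → ℝ} {γ : ℝ}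
    (hγ : 0 < γ) {H : ℕ → E → E} {m : ℕ} (hm : 1 ≤ m)
    (hmem : ∀ i, iter p X θ dθ x₀ R φ (fun _ => γ) H i ∈ X) (xs : E) :
    compositeObjective P G p κ (approxSol p X θ dθ x₀ R φ (fun _ => γ) H m)
        - compositeObjective P G p κ xs ≤
      (m : ℝ)⁻¹ * ∑ i ∈ Finset.range m,
        (compositeObjective P G p κ (iter p X θ dθ x₀ R φ (fun _ => γ) H i)
          - compositeObjective P G p κ xs) := by
  have hm0 : (0 : ℝ) < m := by exact_mod_cast hm
  have hj := (compositeObjective_convexOn h hκ).map_sum_le (t := Finset.range m)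
    (w := fun _ => (m : ℝ)⁻¹) (p := fun i => iter p X θ dθ x₀ R φ (fun _ => γ) H i)
    (fun _ _ => by positivity) (by simp [hm0.ne']) (fun i _ => hmem i)
  rw [← approxSol_eq_sum hγ hm] at hj
  rw [Finset.sum_sub_distrib, mul_sub, Finset.mul_sum]
  simp only [smul_eq_mul] at hj
  simp [hm0.ne'] at hj ⊢
  exact hj

end Deterministic

/-! ### High-probability bound for plain CSMD -/

section Main

variable {E : Type*} [NormedAddCommGroup E] [InnerProductSpace ℝ E] [FiniteDimensional ℝ E]
  [CompleteSpace E] [MeasurableSpace E] [BorelSpace E] {Ω : Type*} [MeasurableSpace Ω]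
  {P : Measure Ω}

/-- A Carathéodory argument: continuous in the point, measurable in the sample. The point ranges
over a subtype because both properties are available only on `X`. -/
theorem measurable_gradient {p : Seminorm ℝ E} (hp : ∀ x : E, p x = 0 → x = 0)
    {X : Set E} {G : E → Ω → ℝ} {dG : E → Ω → E} {dg : E → E} {lip : Ω → ℝ} {ν : ℝ}
    (h : IsProblem p X P G dG dg lip ν) {K : Set E} (hK : K ⊆ X) :
    Measurable (Function.uncurry fun (y : K) ω => dG y ω) :=
  measurable_uncurry_of_continuous_of_measurable
    (fun ω => continuousOn_iff_continuous_domRestrict.1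
      ((gradient_continuousOn hp (h.lipschitz ω)).mono hK))
    fun y => h.grad_measurable y (hK y.2)

theorem measurable_prox_step {p : Seminorm ℝ E} (hp : ∀ x : E, p x = 0 → x = 0)
    {θ : E → ℝ} {dθ : E → E} (hθ : IsDGF p θ dθ)
    {X : Set E} {G : E → Ω → ℝ} {dG : E → Ω → E} {dg : E → E} {lip : Ω → ℝ} {ν : ℝ}
    (h : IsProblem p X P G dG dg lip ν) {x₀ : E} (hx₀ : x₀ ∈ X) {R : ℝ} (hR : 0 < R)
    {φ : E → ℝ} (hφ : Continuous φ) (hφc : ConvexOn ℝ univ φ) (γ : ℝ) :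
    Measurable (Function.uncurry fun (y : localBall p X x₀ R) ω =>
      prox p X θ dθ x₀ R φ (γ • dG y ω) y) := by
  simp only [prox_eq_argmin]
  have hc : Continuous (argmin (localBall p X x₀ R) φ (localDGF θ x₀ R)) :=
    argmin_continuous hp (localBall_isCompact p hp h.isClosed x₀ R)
      ⟨x₀, mem_localBall_self p hx₀ hR.le⟩ hφ.continuousOn
      (hφc.subset (subset_univ _) (localBall_convex p h.convex x₀ R))
      (fun y hy => localDGF_hasGradient hθ hR hy) (localDGF_strong hθ hR)
  have hd : Measurable fun y : localBall p X x₀ R => localDGFGrad dθ x₀ R y :=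
    (continuousOn_iff_continuous_domRestrict.1 (localDGFGrad_continuousOn hθ hR)).measurable
  exact hc.measurable.comp (((measurable_gradient hp h fun y hy => hy.1).const_smul γ).sub
    (hd.comp measurable_fst))

omit [MeasurableSpace E] [BorelSpace E] in
theorem iter_mem {p : Seminorm ℝ E} (hp : ∀ x : E, p x = 0 → x = 0)
    {θ : E → ℝ} {dθ : E → E} (hθ : IsDGF p θ dθ) {X : Set E} (hX : IsClosed X)
    {x₀ : E} (hx₀ : x₀ ∈ X) {R : ℝ} (hR : 0 < R) {h : E → ℝ} (hh : Continuous h)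
    (γ : ℕ → ℝ) (H : ℕ → E → E) (i : ℕ) :
    iter p X θ dθ x₀ R h γ H i ∈ localBall p X x₀ R := by
  cases i with
  | zero => exact mem_localBall_self p hx₀ hR.le
  | succ i => exact (prox_spec hp hθ hX hx₀ hR (by fun_prop) _ _).1

/-- The normalized error made in one step at the point `y`: a convex combination of three
quantities with exponential moment at most one. -/
noncomputable def stepError (P : Measure Ω) (p : Seminorm ℝ E) (dG : E → Ω → E) (xs : E)
    (R γ σ : ℝ) (y : E) (ω : Ω) : ℝ :=
  (3 / 2 * R ^ 2 / (7 / 2 * R ^ 2 + γ ^ 2 * σ ^ 2)) *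
      (1 / 2 * (3 / 4 * (∫ ω', γ / R ^ 2 * inner ℝ (dG y ω' - dG xs ω') (y - xs) ∂P) -
        γ / R ^ 2 * inner ℝ (dG y ω - dG xs ω) (y - xs))) +
    (1 - 3 / 2 * R ^ 2 / (7 / 2 * R ^ 2 + γ ^ 2 * σ ^ 2)) *
      ((γ ^ 2 * σ ^ 2 / (2 * R ^ 2 + γ ^ 2 * σ ^ 2)) * ((dualNorm p (dG xs ω) / σ) ^ 2 - 1) +
        (1 - γ ^ 2 * σ ^ 2 / (2 * R ^ 2 + γ ^ 2 * σ ^ 2)) *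
          (γ * σ / R * ((2 * R * σ)⁻¹ * inner ℝ (xs - y) (dG xs ω)) - (γ * σ / R) ^ 2))

omit [FiniteDimensional ℝ E] [CompleteSpace E] [MeasurableSpace E] [BorelSpace E] in
-- The nested weights are chosen so that, after multiplication by 7/2 R² + γ²σ², the three errors
-- get coefficients 3/2 R², γ²σ² and 2R². The drift 3γ²σ² collects γ²σ² from centering
-- ‖∇G(x_*,ω)‖_*² and 2γ²σ² from the sub-Gaussian compensator.
theorem stepError_eq {p : Seminorm ℝ E} {dG : E → Ω → E} {xs : E}
    {R γ σ : ℝ} (hR : 0 < R) (hσ : 0 < σ) (y : E) (ω : Ω) :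
    (7 / 2 * R ^ 2 + γ ^ 2 * σ ^ 2) * stepError P p dG xs R γ σ y ω + 3 * (γ ^ 2 * σ ^ 2) =
      9 / 16 * (γ * ∫ ω', inner ℝ (dG y ω' - dG xs ω') (y - xs) ∂P)
        - 3 / 4 * (γ * inner ℝ (dG y ω - dG xs ω) (y - xs))
        + γ ^ 2 * dualNorm p (dG xs ω) ^ 2 - γ * inner ℝ (dG xs ω) (y - xs) := by
  have hin : inner ℝ (xs - y) (dG xs ω) = - inner ℝ (dG xs ω) (y - xs) := by
    rw [real_inner_comm, ← neg_sub, inner_neg_right]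
  rw [stepError, integral_const_mul, hin]
  generalize inner ℝ (dG xs ω) (y - xs) = b
  generalize inner ℝ (dG y ω - dG xs ω) (y - xs) = q
  generalize (∫ ω', inner ℝ (dG y ω' - dG xs ω') (y - xs) ∂P) = Q
  generalize dualNorm p (dG xs ω) = s
  have h1 : 2 * R ^ 2 + γ ^ 2 * σ ^ 2 ≠ 0 := by positivity
  have h2 : 7 / 2 * R ^ 2 + γ ^ 2 * σ ^ 2 ≠ 0 := by positivity
  have e1 : 1 - 3 / 2 * R ^ 2 / (7 / 2 * R ^ 2 + γ ^ 2 * σ ^ 2) =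
      (2 * R ^ 2 + γ ^ 2 * σ ^ 2) / (7 / 2 * R ^ 2 + γ ^ 2 * σ ^ 2) := by
    rw [eq_div_iff h2, sub_mul, div_mul_cancel₀ _ h2]; ring
  have e2 : 1 - γ ^ 2 * σ ^ 2 / (2 * R ^ 2 + γ ^ 2 * σ ^ 2) =
      2 * R ^ 2 / (2 * R ^ 2 + γ ^ 2 * σ ^ 2) := by
    rw [eq_div_iff h1, sub_mul, div_mul_cancel₀ _ h1]; ring
  rw [e1, e2]
  generalize hc1 : 2 * R ^ 2 + γ ^ 2 * σ ^ 2 = c1 at h1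
  generalize 7 / 2 * R ^ 2 + γ ^ 2 * σ ^ 2 = c2 at h2
  field_simp
  ring

theorem measurable_stepError [IsProbabilityMeasure P]
    {p : Seminorm ℝ E} (hp : ∀ x : E, p x = 0 → x = 0)
    {X : Set E} {G : E → Ω → ℝ} {dG : E → Ω → E} {dg : E → E} {lip : Ω → ℝ} {ν : ℝ}
    (h : IsProblem p X P G dG dg lip ν) {K : Set E} (hK : K ⊆ X) {xs : E} (hxs : xs ∈ X)
    (R γ σ : ℝ) :
    Measurable (Function.uncurry fun (y : K) ω => stepError P p dG xs R γ σ y ω) := by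
  have h1 := measurable_gradient hp h hK
  have h2 : Measurable fun q : K × Ω => dG xs q.2 := (h.grad_measurable xs hxs).comp measurable_snd
  have h3 : Measurable fun q : K × Ω => (q.1 : E) := measurable_subtype_coe.comp measurable_fst
  have h4 : Measurable fun q : K × Ω =>
      γ / R ^ 2 * inner ℝ (dG q.1 q.2 - dG xs q.2) ((q.1 : E) - xs) :=
    ((h1.sub h2).inner (h3.sub_const xs)).const_mul _
  have h5 : Measurable fun y : K => ∫ ω', γ / R ^ 2 * inner ℝ (dG y ω' - dG xs ω') (y - xs) ∂P :=
    h4.stronglyMeasurable.integral_prod_right.measurable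
  have h6 : Measurable fun q : K × Ω => dualNorm p (dG xs q.2) :=
    (dualNorm_continuous p hp).measurable.comp h2
  have h7 : Measurable fun q : K × Ω => (inner ℝ (xs - q.1) (dG xs q.2) : ℝ) :=
    (h3.const_sub xs).inner h2
  exact ((((h5.comp measurable_fst).const_mul _).sub h4).const_mul _ |>.const_mul _).add
    ((((((h6.div_const σ).pow_const 2).sub_const 1).const_mul _).add
      (((h7.const_mul _).const_mul _ |>.sub_const _).const_mul _)).const_mul _)

omit [FiniteDimensional ℝ E] [CompleteSpace E] [MeasurableSpace E] [BorelSpace E] in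
theorem seminorm_sub_le_two_mul {p : Seminorm ℝ E} {X : Set E} {x₀ : E} {R : ℝ} {y z : E}
    (hy : y ∈ localBall p X x₀ R) (hz : z ∈ localBall p X x₀ R) : p (y - z) ≤ 2 * R := by
  have h1 := map_sub_le_add p (y - x₀) (z - x₀)
  rw [sub_sub_sub_cancel_right] at h1
  linarith [hy.2, hz.2]

/-- Points of the local ball are within 2R of each other. Hence the scaled monotone term is at most
4γν ≤ 1, as the lower-tail bound requires, and the scaled noise product is dominated by
‖∇G(x_*,ω)‖_*/σ; it is centered because ∇g(x_*) = 0. -/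
theorem lintegral_exp_stepError_le_one [IsProbabilityMeasure P]
    {p : Seminorm ℝ E} (hp : ∀ x : E, p x = 0 → x = 0)
    {X : Set E} {G : E → Ω → ℝ} {dG : E → Ω → E} {dg : E → E} {lip : Ω → ℝ} {ν : ℝ}
    (hν : 0 < ν)
    (h : IsProblem p X P G dG dg lip ν) {x₀ : E} {R γ σ : ℝ} (hR : 0 < R) (hγ : 0 < γ)
    (hσ : 0 < σ) (hγν : γ * ν ≤ 1 / 4) {xs y : E} (hxs : xs ∈ localBall p X x₀ R)
    (hgrad : dg xs = 0) (hsub : IsSubGaussian p P (dG xs) σ) (hy : y ∈ localBall p X x₀ R) :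
    ∫⁻ ω, ENNReal.ofReal (Real.exp (stepError P p dG xs R γ σ y ω)) ∂P ≤ 1 := by
  have hm1 : Measurable (dG y) := h.grad_measurable y hy.1
  have hm2 : Measurable (dG xs) := h.grad_measurable xs hxs.1
  have hq : Measurable fun ω => γ / R ^ 2 * inner ℝ (dG y ω - dG xs ω) (y - xs) :=
    ((hm1.sub hm2).inner_const).const_mul _
  have hU : Measurable fun ω => dualNorm p (dG xs ω) / σ :=
    ((dualNorm_continuous p hp).measurable.comp hm2).div_const σ
  have hpy := seminorm_sub_le_two_mul hy hxs
  refine lintegral_exp_comb_le_one (by fun_prop) ?_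
    (lintegral_exp_comb_le_one (by fun_prop) hsub.lintegral_le_one ?_ (by positivity) ?_)
    (by positivity) ?_
  · refine lintegral_exp_lower_le_one hq (Eventually.of_forall fun ω => ?_) ?_
    · exact mul_nonneg (by positivity) (gradient_monotone h ω hy.1 hxs.1)
    · filter_upwards [h.lip_le] with ω hω
      have h1 := inner_le_dualNorm_mul p hp (dG y ω - dG xs ω) (y - xs)
      have h2 : dualNorm p (dG y ω - dG xs ω) ≤ ν * p (y - xs) :=
        (h.lipschitz ω y hy.1 xs hxs.1).trans
          (mul_le_mul_of_nonneg_right hω (apply_nonneg p _))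
      have h0 := apply_nonneg p (y - xs)
      have h3 : inner ℝ (dG y ω - dG xs ω) (y - xs) ≤ ν * (2 * R) ^ 2 := by
        calc _ ≤ _ := h1
          _ ≤ ν * p (y - xs) * p (y - xs) := mul_le_mul_of_nonneg_right h2 h0
          _ = ν * p (y - xs) ^ 2 := by ring
          _ ≤ ν * (2 * R) ^ 2 :=
            mul_le_mul_of_nonneg_left (pow_le_pow_left₀ h0 hpy 2) hν.le
      rw [div_mul_eq_mul_div, div_le_one (by positivity)]
      calc γ * _ ≤ γ * (ν * (2 * R) ^ 2) := mul_le_mul_of_nonneg_left h3 hγ.le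
        _ = (γ * ν) * (4 * R ^ 2) := by ring
        _ ≤ 1 / 4 * (4 * R ^ 2) := mul_le_mul_of_nonneg_right hγν (by positivity)
        _ = R ^ 2 := by ring
  · refine lintegral_exp_centered_le_one (U := fun ω => dualNorm p (dG xs ω) / σ)
      (((h.grad_integrable xs hxs.1).const_inner _).const_mul _) ?_ hU (fun ω => ?_)
      hsub.lintegral_le_one _
    · rw [integral_const_mul, integral_inner (h.grad_integrable xs hxs.1), h.unbiased xs hxs.1,
        hgrad, inner_zero_right, mul_zero]
    · have h1 := abs_inner_le_dualNorm_mul p hp (dG xs ω) (xs - y)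
      have h0 := dualNorm_nonneg p hp (dG xs ω)
      rw [real_inner_comm, ← neg_sub y xs, map_neg_eq_map] at h1
      rw [abs_mul, abs_of_pos (by positivity : 0 < (2 * R * σ)⁻¹), inv_mul_le_iff₀ (by positivity)]
      rw [← neg_sub y xs]
      calc _ ≤ _ := h1
        _ ≤ dualNorm p (dG xs ω) * (2 * R) := mul_le_mul_of_nonneg_left hpy h0
        _ = _ := by field_simp
  · rw [div_le_one (by positivity)]
    nlinarith [sq_nonneg R]
  · rw [div_le_one (by positivity)]
    nlinarith [sq_nonneg R, sq_nonneg (γ * σ)]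

theorem csmd_bound [IsProbabilityMeasure P]
    {S : Type*} [MeasurableSpace S] {μ : Measure S} [IsProbabilityMeasure μ]
    {p : Seminorm ℝ E} (hp : ∀ x : E, p x = 0 → x = 0)
    {θ : E → ℝ} {dθ : E → E} (hθ : IsDGF p θ dθ)
    {X : Set E} {G : E → Ω → ℝ} {dG : E → Ω → E} {dg : E → E} {lip : Ω → ℝ} {ν : ℝ}
    (hν : 0 < ν) (h : IsProblem p X P G dG dg lip ν)
    {R κ γ σ : ℝ} (hR : 0 < R) (hκ : 0 ≤ κ) (hγ : 0 < γ) (hγν : γ ≤ (4 * ν)⁻¹) (hσ : 0 < σ)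
    {x₀ xs : E} (hx₀ : x₀ ∈ X) (hxs : xs ∈ localBall p X x₀ R)
    (hgrad : dg xs = 0) (hsub : IsSubGaussian p P (dG xs) σ)
    {m : ℕ} (hm : 1 ≤ m) {t : ℝ} (ht : 0 ≤ t) {ξ : ℕ → S → Ω} (hξ : IsSampleSequence μ P ξ) :
    ENNReal.ofReal (1 - Real.exp (-t)) ≤
      μ {s : S |
        compositeObjective P G p κ
            (approxSol p X θ dθ x₀ R (fun z => κ * p z) (fun _ => γ) (oracle dG (fun i => ξ i s)) m)
          - compositeObjective P G p κ xs
        ≤ 4 * ((m : ℝ)⁻¹ * (γ⁻¹ * R ^ 2 * (bigTheta p θ + t) + κ * R + γ * σ ^ 2 * (m + t)))} := by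
  have hγν' : γ * ν ≤ 1 / 4 := by
    rw [mul_inv, ← div_eq_mul_inv, le_div_iff₀ hν] at hγν
    linarith
  have hpc := seminorm_continuous p
  have hφ : Continuous fun z => γ * (κ * p z) := by fun_prop
  have hφc : ConvexOn ℝ univ (fun v => γ * (κ * p v)) := (p.convexOn.smul hκ).smul hγ.le
  let K := localBall p X x₀ R
  let x : S → ℕ → E := fun s =>
    iter p X θ dθ x₀ R (fun z => κ * p z) (fun _ => γ) (oracle dG (fun i => ξ i s))
  have hxK : ∀ s i, x s i ∈ K := fun s i =>
    iter_mem hp hθ h.isClosed hx₀ hR (by fun_prop) _ _ i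
  have hprox : ∀ ζ v, IsProx p X θ dθ x₀ R (fun z => γ * (κ * p z)) ζ v
      (prox p X θ dθ x₀ R (fun z => γ * (κ * p z)) ζ v) :=
    fun ζ v => prox_spec hp hθ h.isClosed hx₀ hR hφ ζ v
  have htail := process_tail hξ (Y := K)
    (step := fun y ω =>
      ⟨prox p X θ dθ x₀ R (fun z => γ * (κ * p z)) (γ • dG y ω) y, (hprox _ _).1⟩)
    ((measurable_prox_step hp hθ h hx₀ hR hφ hφc γ).subtype_mk)
    (y := fun i s => ⟨x s i, hxK s i⟩) (y₀ := ⟨x₀, mem_localBall_self p hx₀ hR.le⟩)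
    (fun s => rfl) (fun i s => rfl)
    (A := fun y ω => stepError P p dG xs R γ σ y ω)
    (measurable_stepError hp h (fun y hy => hy.1) hxs.1 R γ σ)
    (fun y => lintegral_exp_stepError_le_one hp hν h hR hγ hσ hγν' hxs hgrad hsub y.2) m t
  refine htail.trans (measure_mono_ae ?_)
  -- The Lipschitz constant is at most `ν` only almost surely, so cocoercivity with `ν` along the
  -- whole trajectory holds off a null set.
  have hlip : ∀ᵐ s ∂μ, ∀ i, lip (ξ i s) ≤ ν :=
    ae_all_iff.2 fun i => (hξ.measurePreserving i).quasiMeasurePreserving.ae h.lip_le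
  filter_upwards [hlip] with s hs hA
  have hA' : ∑ i ∈ Finset.range m, stepError P p dG xs R γ σ (x s i) (ξ i s) ≤ t := hA
  set c := 7 / 2 * R ^ 2 + γ ^ 2 * σ ^ 2 with hc
  let V : ℕ → ℝ := fun i => bregman θ dθ x₀ R (x s i) xs
  let gap : ℕ → ℝ := fun i =>
    compositeObjective P G p κ (x s i) - compositeObjective P G p κ xs
  -- The prox step controls `p` at the new iterate, while the gap is measured at the old one; the
  -- difference is kept on the left because it telescopes.
  have hstep : ∀ i, γ * gap i + γ * κ * (p (x s (i + 1)) - p (x s i)) ≤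
      V i - V (i + 1) + c * stepError P p dG xs R γ σ (x s i) (ξ i s) + 3 * (γ ^ 2 * σ ^ 2) :=
      fun i => by
    set y := x s i with hy
    set ω := ξ i s with hω
    have hyK : y ∈ K := hxK s i
    have hw : IsProx p X θ dθ x₀ R (fun v => γ * (κ * p v))
        (γ • (dG y ω - dG xs ω + dG xs ω)) y (x s (i + 1)) := by
      rw [sub_add_cancel]
      exact hprox _ _
    have hwK : x s (i + 1) ∈ K := hxK s (i + 1)
    have h1 := step_bound hθ h.convex hR hκ hγ hν hγν' hw hyK hxs
      (s := dualNorm p (dG xs ω)) (gradient_monotone h ω hyK.1 hxs.1)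
      (cocoercive hp hν (h.convexOn ω) (h.hasGradient ω)
        (fun u hu v hv => (h.lipschitz ω u hu v hv).trans
          (mul_le_mul_of_nonneg_right (hs i) (apply_nonneg p _))) hyK.1 hxs.1 hyK.1 hwK.1)
      (inner_le_dualNorm_mul p hp _ _)
    have h2 := stepError_eq (P := P) (p := p) (dG := dG) (xs := xs) (γ := γ) hR hσ y ω
    have h3 : ∫ ω', inner ℝ (dG y ω' - dG xs ω') (y - xs) ∂P = inner ℝ (dg y) (y - xs) := by
      have hi := (h.grad_integrable y hyK.1).sub (h.grad_integrable xs hxs.1)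
      have := integral_inner (𝕜 := ℝ) hi (y - xs)
      simp only [Pi.sub_apply] at this
      rw [integral_sub (h.grad_integrable y hyK.1) (h.grad_integrable xs hxs.1),
        h.unbiased y hyK.1, h.unbiased xs hxs.1, hgrad, sub_zero] at this
      rw [real_inner_comm, ← this]
      exact integral_congr_ae (Eventually.of_forall fun ω' =>
        real_inner_comm (y - xs) (dG y ω' - dG xs ω'))
    have h4 := inner_gradient_le h.mean_convexOn hyK.1 hxs.1 (h.mean_hasGradient y hyK.1)
    have h5 := inner_gradient_le h.mean_convexOn hxs.1 hyK.1 (h.mean_hasGradient xs hxs.1)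
    rw [hgrad, inner_zero_left] at h5
    rw [← neg_sub, inner_neg_right] at h4
    rw [h3, ← hc] at h2
    have h6 : γ * gap i = γ * (1 / 2 * (objective P G y - objective P G xs)) +
        γ * κ * (p y - p xs) := by
      simp only [gap, compositeObjective]
      ring
    -- Passing from 1/2 to 9/16 needs g(y) ≥ g(x_*), supplied by `h5`; convexity then bounds the gap
    -- by ⟨∇g(y), y - x_*⟩.
    have h7 : γ * (1 / 2 * (objective P G y - objective P G xs)) ≤
        γ * (9 / 16 * inner ℝ (dg y) (y - xs)) :=
      mul_le_mul_of_nonneg_left (by linarith) hγ.le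
    simp only [V, ← hy]
    rw [h6]
    linarith
  have hsum : ∀ n : ℕ, γ * ∑ i ∈ Finset.range n, gap i + γ * κ * (p (x s n) - p (x s 0)) ≤
      V 0 - V n + c * ∑ i ∈ Finset.range n, stepError P p dG xs R γ σ (x s i) (ξ i s) +
        n * (3 * (γ ^ 2 * σ ^ 2)) := fun n => by
    induction n with
    | zero => simp
    | succ n ih =>
      rw [Finset.sum_range_succ, Finset.sum_range_succ]
      push_cast
      linarith [hstep n]
  have hV0 : V 0 ≤ R ^ 2 * bigTheta p θ := bregman_center_le hp hθ hR hxs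
  have hVm : 0 ≤ V m :=
    le_trans (by positivity) (half_sq_le_bregman hθ h.convex hR (hxK s m) hxs)
  -- All that remains of the telescoped regularizer; it is the source of the term κR.
  have hpm : -R ≤ p (x s m) - p (x s 0) := by
    have h1 := map_add_le_add p (x s m) (x s 0 - x s m)
    rw [add_sub_cancel, map_sub_rev] at h1
    have h2 : p (x s m - x₀) ≤ R := (hxK s m).2
    have h3 : x s 0 = x₀ := rfl
    rw [h3] at h1 ⊢
    linarith
  have hc0 : 0 ≤ c := by positivity
  have hm0 : (0 : ℝ) < m := by exact_mod_cast hm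
  have hΘ := bigTheta_nonneg hp hθ
  have htot : γ * ∑ i ∈ Finset.range m, gap i ≤
      R ^ 2 * bigTheta p θ + γ * κ * R + c * t + m * (3 * (γ ^ 2 * σ ^ 2)) := by
    have h1 := hsum m
    have h2 := mul_le_mul_of_nonneg_left hA' hc0
    have h3 := mul_le_mul_of_nonneg_left hpm (mul_nonneg hγ.le hκ)
    linarith
  refine (approxSol_gap_le h hκ hγ hm (fun i => (hxK s i).1) xs).trans ?_
  -- The factor 4 dominates 7/2, the coefficient of R²t, and 3, that of γ²σ²m.
  have hfin : ∑ i ∈ Finset.range m, gap i ≤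
      4 * (γ⁻¹ * R ^ 2 * (bigTheta p θ + t) + κ * R + γ * σ ^ 2 * (m + t)) := by
    refine le_of_mul_le_mul_left (htot.trans ?_) hγ
    have e : γ * (4 * (γ⁻¹ * R ^ 2 * (bigTheta p θ + t) + κ * R + γ * σ ^ 2 * (m + t))) =
        4 * (R ^ 2 * (bigTheta p θ + t) + γ * κ * R + γ ^ 2 * σ ^ 2 * (m + t)) := by
      field_simp
    rw [e, hc]
    have p1 : 0 ≤ R ^ 2 * bigTheta p θ := by positivity
    have p2 : 0 ≤ R ^ 2 * t := by positivity
    have p3 : 0 ≤ γ * κ * R := by positivity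
    have p4 : 0 ≤ γ ^ 2 * σ ^ 2 * m := by positivity
    have p5 : 0 ≤ γ ^ 2 * σ ^ 2 * t := by positivity
    nlinarith
  calc (m : ℝ)⁻¹ * ∑ i ∈ Finset.range m, gap i ≤ (m : ℝ)⁻¹ * _ :=
        mul_le_mul_of_nonneg_left hfin (by positivity)
    _ = _ := by ring

end Main

/-! ### A smooth potential for the conjugate norm -/

section Potential

variable {E : Type*} [NormedAddCommGroup E] [InnerProductSpace ℝ E]

/-- The maximizer of `⟨y, z⟩ - β θ(z)` over the unit ball of `p`. -/
noncomputable def potentialGrad (p : Seminorm ℝ E) (θ : E → ℝ) (β : ℝ) (y : E) : E :=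
  argmin {z : E | p z ≤ 1} (fun _ => 0) θ (-(β⁻¹ • y))

/-- The maximum of `⟨y, z⟩ - β θ(z)` over the unit ball of `p`. -/
noncomputable def potential (p : Seminorm ℝ E) (θ : E → ℝ) (β : ℝ) (y : E) : ℝ :=
  inner ℝ y (potentialGrad p θ β y) - β * θ (potentialGrad p θ β y)

variable [FiniteDimensional ℝ E] [CompleteSpace E] {p : Seminorm ℝ E} {θ : E → ℝ} {dθ : E → E}

theorem potentialGrad_spec (hp : ∀ x : E, p x = 0 → x = 0) (hθ : IsDGF p θ dθ) (β : ℝ) (y : E) :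
    p (potentialGrad p θ β y) ≤ 1 ∧
      IsMinOn (fun z => inner ℝ (-(β⁻¹ • y)) z + 0 + θ z) {z : E | p z ≤ 1}
        (potentialGrad p θ β y) := by
  have hK := isCompact_seminorm_closedBall p hp 0 1
  simp only [sub_zero] at hK
  exact argmin_spec hK ⟨0, by simp⟩ continuousOn_const (dgf_continuousOn hθ) _

theorem potentialGrad_continuous (hp : ∀ x : E, p x = 0 → x = 0) (hθ : IsDGF p θ dθ) (β : ℝ) :
    Continuous (potentialGrad p θ β) := by
  have hK := isCompact_seminorm_closedBall p hp 0 1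
  simp only [sub_zero] at hK
  have := argmin_continuous hp hK ⟨0, by simp⟩ continuousOn_const
    (convexOn_const 0 (unitBall_convex p)) hθ.hasGradient
    (fun x hx z hz => hθ.strong x z hx hz)
  exact this.comp (by fun_prop)

/-- Strong convexity of `θ` makes the maximized function fall off quadratically from its maximizer.
-/
theorem sub_le_potential (hp : ∀ x : E, p x = 0 → x = 0) (hθ : IsDGF p θ dθ) {β : ℝ} (hβ : 0 < β)
    (y : E) {z : E} (hz : p z ≤ 1) :
    inner ℝ y z - β * θ z ≤
      potential p θ β y - β / 2 * p (z - potentialGrad p θ β y) ^ 2 := by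
  obtain ⟨hw, hmin⟩ := potentialGrad_spec hp hθ β y
  set w := potentialGrad p θ β y with hwdef
  have h1 := optimality_of_isMinOn (convexOn_const 0 (unitBall_convex p)) (hθ.hasGradient w hw) hw
    hmin hz
  have h2 := bregman_lower (p := p) (unitBall_convex p) (f := θ) (d := dθ) (c := 1)
    hθ.hasGradient (fun x hx z hz => by rw [one_mul]; exact hθ.strong x z hx hz) hw hz
  simp only [inner_neg_left, real_inner_smul_left, add_zero] at h1
  have h3 : 1 / 2 * p (z - w) ^ 2 ≤ θ z - θ w + β⁻¹ * inner ℝ y w - β⁻¹ * inner ℝ y z := by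
    linarith
  have h4 := mul_le_mul_of_nonneg_left h3 hβ.le
  have h5 : β * (θ z - θ w + β⁻¹ * inner ℝ y w - β⁻¹ * inner ℝ y z) =
      β * θ z - β * θ w + inner ℝ y w - inner ℝ y z := by
    field_simp
  rw [h5] at h4
  rw [potential, ← hwdef]
  linarith

theorem potential_zero_le (hp : ∀ x : E, p x = 0 → x = 0) (hθ : IsDGF p θ dθ) {β : ℝ}
    (hβ : 0 < β) : potential p θ β 0 ≤ 0 := by
  have := hθ.nonneg _ (potentialGrad_spec hp hθ β 0).1
  rw [potential, inner_zero_left, zero_sub, neg_nonpos]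
  positivity

theorem dualNorm_le_potential (hp : ∀ x : E, p x = 0 → x = 0) (hθ : IsDGF p θ dθ) {β : ℝ}
    (hβ : 0 < β) (y : E) : dualNorm p y ≤ potential p θ β y + β * bigTheta p θ := by
  refine dualNorm_le p fun z hz => ?_
  have h1 := sub_le_potential hp hθ hβ y hz
  have h2 := mul_le_mul_of_nonneg_left (le_bigTheta hp hθ hz) hβ.le
  have h3 : 0 ≤ β / 2 * p (z - potentialGrad p θ β y) ^ 2 := by positivity
  linarith

/-- Smoothness of the potential, dual to strong convexity of `θ`: the quadratic loss of the new
maximizer in the old problem absorbs ⟨η, z - w⟩ by Young's inequality. -/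
theorem potential_add_le (hp : ∀ x : E, p x = 0 → x = 0) (hθ : IsDGF p θ dθ) {β : ℝ}
    (hβ : 0 < β) (y η : E) :
    potential p θ β (y + η) ≤ potential p θ β y + inner ℝ (potentialGrad p θ β y) η +
      dualNorm p η ^ 2 / (2 * β) := by
  set z := potentialGrad p θ β (y + η) with hz
  set w := potentialGrad p θ β y with hw
  have h1 := sub_le_potential hp hθ hβ y (potentialGrad_spec hp hθ β (y + η)).1
  rw [← hz, ← hw] at h1
  have h2 := inner_le_dualNorm_mul p hp η (z - w)
  have h3 : dualNorm p η * p (z - w) ≤ dualNorm p η ^ 2 / (2 * β) + β / 2 * p (z - w) ^ 2 := by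
    have h4 : dualNorm p η ^ 2 / (2 * β) + β / 2 * p (z - w) ^ 2 - dualNorm p η * p (z - w) =
        (dualNorm p η - β * p (z - w)) ^ 2 / (2 * β) := by
      field_simp
      ring
    have h5 : 0 ≤ (dualNorm p η - β * p (z - w)) ^ 2 / (2 * β) := by positivity
    linarith
  rw [potential, ← hz, inner_add_left, real_inner_comm η w]
  rw [inner_sub_right] at h2
  linarith

/-- The vector paired with η_i depends only on the preceding summands. For independent centered
summands the linear terms are therefore martingale differences, and the norm of a sum is reduced to
scalar exponential moments. -/
theorem dualNorm_sum_le_potential (hp : ∀ x : E, p x = 0 → x = 0) (hθ : IsDGF p θ dθ) {β : ℝ}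
    (hβ : 0 < β) (η : ℕ → E) (n : ℕ) :
    dualNorm p (∑ i ∈ Finset.range n, η i) ≤ β * bigTheta p θ + ∑ i ∈ Finset.range n,
      (inner ℝ (potentialGrad p θ β (∑ j ∈ Finset.range i, η j)) (η i) +
        dualNorm p (η i) ^ 2 / (2 * β)) := by
  have h1 : ∀ n : ℕ, potential p θ β (∑ i ∈ Finset.range n, η i) ≤ ∑ i ∈ Finset.range n,
      (inner ℝ (potentialGrad p θ β (∑ j ∈ Finset.range i, η j)) (η i) +
        dualNorm p (η i) ^ 2 / (2 * β)) := fun n => by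
    induction n with
    | zero => simpa using potential_zero_le hp hθ hβ
    | succ n ih =>
      rw [Finset.sum_range_succ, Finset.sum_range_succ]
      have := potential_add_le hp hθ hβ (∑ i ∈ Finset.range n, η i) (η n)
      linarith
  linarith [h1 n, dualNorm_le_potential hp hθ hβ (∑ i ∈ Finset.range n, η i)]

end Potential

/-! ### From exponential moments to the exponential moment of the square -/

section SquareMoment

variable {Ω : Type*} [MeasurableSpace Ω] {P : Measure Ω} [IsProbabilityMeasure P]

theorem lintegral_exp_neg_mul_sq {b : ℝ} (hb : 0 < b) (c : ℝ) :
    ∫⁻ x : ℝ, ENNReal.ofReal (Real.exp (-b * (x - c) ^ 2)) =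
      ENNReal.ofReal (Real.sqrt (Real.pi / b)) := by
  rw [lintegral_sub_right_eq_self (fun x : ℝ => ENNReal.ofReal (Real.exp (-b * x ^ 2))) c,
    ← integral_gaussian, ofReal_integral_eq_lintegral_ofReal (integrable_exp_neg_mul_sq hb)
      (Eventually.of_forall fun _ => (Real.exp_pos _).le)]

/-- A sub-Gaussian bound on the moment generating function of a nonnegative variable bounds
the exponential moment of its square. -/
theorem lintegral_exp_sq_le_one {u : Ω → ℝ} (hu : Measurable u) (hu0 : ∀ ω, 0 ≤ u ω) {D : ℝ}
    (hD : 0 < D)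
    (h : ∀ l : ℝ, 0 ≤ l → ∫⁻ ω, ENNReal.ofReal (Real.exp (l * u ω)) ∂P ≤
      ENNReal.ofReal (Real.exp (1 + 6 * l ^ 2 * D))) :
    ∫⁻ ω, ENNReal.ofReal (Real.exp (u ω ^ 2 / (96 * D) - 1)) ∂P ≤ 1 := by
  have h' : ∀ x : ℝ, ∫⁻ ω, ENNReal.ofReal (Real.exp (x * u ω)) ∂P ≤
      ENNReal.ofReal (Real.exp (1 + 6 * x ^ 2 * D)) := fun x => by
    have h1 := h |x| (abs_nonneg x)
    rw [sq_abs] at h1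
    refine (lintegral_mono fun ω => ENNReal.ofReal_le_ofReal (Real.exp_le_exp.2 ?_)).trans h1
    exact mul_le_mul_of_nonneg_right (le_abs_self x) (hu0 ω)
  -- Completing the square writes exp(u²/(4b)) as a Gaussian average of exp(xu). With b = 12D the
  -- bound exp(6x²D) uses up half of the Gaussian exponent bx²; the rest integrates, at the price of
  -- a factor √2.
  set b := 12 * D with hb
  have hb0 : 0 < b := by positivity
  have hsq : ∀ ω, ENNReal.ofReal (Real.exp (u ω ^ 2 / (48 * D))) *
      ENNReal.ofReal (Real.sqrt (Real.pi / b)) =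
      ∫⁻ x : ℝ, ENNReal.ofReal (Real.exp (-b * x ^ 2)) *
        ENNReal.ofReal (Real.exp (x * u ω)) := fun ω => by
    rw [← lintegral_exp_neg_mul_sq hb0 (u ω / (2 * b)),
      ← lintegral_const_mul' _ _ ENNReal.ofReal_ne_top]
    refine lintegral_congr fun x => ?_
    rw [← ENNReal.ofReal_mul (Real.exp_pos _).le, ← ENNReal.ofReal_mul (Real.exp_pos _).le,
      ← Real.exp_add, ← Real.exp_add]
    congr 2
    rw [hb]
    field_simp
    ring
  have hmeas : Measurable fun q : Ω × ℝ => ENNReal.ofReal (Real.exp (-b * q.2 ^ 2)) *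
      ENNReal.ofReal (Real.exp (q.2 * u q.1)) := by fun_prop
  have hmain : (∫⁻ ω, ENNReal.ofReal (Real.exp (u ω ^ 2 / (48 * D))) ∂P) *
      ENNReal.ofReal (Real.sqrt (Real.pi / b)) ≤
      ENNReal.ofReal (Real.exp 2) * ENNReal.ofReal (Real.sqrt (Real.pi / b)) := by
    calc (∫⁻ ω, ENNReal.ofReal (Real.exp (u ω ^ 2 / (48 * D))) ∂P) *
          ENNReal.ofReal (Real.sqrt (Real.pi / b))
        = ∫⁻ ω, (∫⁻ x : ℝ, ENNReal.ofReal (Real.exp (-b * x ^ 2)) *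
            ENNReal.ofReal (Real.exp (x * u ω))) ∂P := by
          rw [← lintegral_mul_const' _ _ ENNReal.ofReal_ne_top]
          exact lintegral_congr hsq
      _ = ∫⁻ x : ℝ, ∫⁻ ω, ENNReal.ofReal (Real.exp (-b * x ^ 2)) *
            ENNReal.ofReal (Real.exp (x * u ω)) ∂P :=
          lintegral_lintegral_swap hmeas.aemeasurable
      _ ≤ ∫⁻ x : ℝ, ENNReal.ofReal (Real.exp 1) *
            ENNReal.ofReal (Real.exp (-(b / 2) * (x - 0) ^ 2)) := by
          refine lintegral_mono fun x => ?_
          rw [lintegral_const_mul' _ _ ENNReal.ofReal_ne_top]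
          refine (mul_le_mul_right (h' x) _).trans (le_of_eq ?_)
          rw [← ENNReal.ofReal_mul (Real.exp_pos _).le, ← ENNReal.ofReal_mul (Real.exp_pos _).le,
            ← Real.exp_add, ← Real.exp_add]
          congr 2
          rw [hb]
          ring
      _ = ENNReal.ofReal (Real.exp 1) * ENNReal.ofReal (Real.sqrt (Real.pi / (b / 2))) := by
          rw [lintegral_const_mul' _ _ ENNReal.ofReal_ne_top,
            lintegral_exp_neg_mul_sq (half_pos hb0)]
      _ ≤ _ := by
          rw [← ENNReal.ofReal_mul (Real.exp_pos _).le, ← ENNReal.ofReal_mul (Real.exp_pos _).le]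
          refine ENNReal.ofReal_le_ofReal ?_
          have e1 : Real.pi / (b / 2) = 2 * (Real.pi / b) := by field_simp
          have e2 : Real.exp 2 = Real.exp 1 * Real.exp 1 := by rw [← Real.exp_add]; norm_num
          rw [e1, Real.sqrt_mul (by norm_num), e2, mul_assoc]
          refine mul_le_mul_of_nonneg_left (mul_le_mul_of_nonneg_right ?_ (Real.sqrt_nonneg _))
            (Real.exp_pos _).le
          have h2 : Real.sqrt 2 ≤ 2 := by
            rw [Real.sqrt_le_left (by norm_num)]; norm_num
          linarith [Real.add_one_le_exp 1]
  have hpos : 0 < Real.sqrt (Real.pi / b) := Real.sqrt_pos.2 (by positivity)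
  rw [ENNReal.mul_le_mul_iff_left (ENNReal.ofReal_pos.2 hpos).ne' ENNReal.ofReal_ne_top] at hmain
  have hone : ∫⁻ ω, ENNReal.ofReal (Real.exp (u ω ^ 2 / (48 * D) - 2)) ∂P ≤ 1 := by
    have e : ∀ ω, ENNReal.ofReal (Real.exp (u ω ^ 2 / (48 * D) - 2)) =
        ENNReal.ofReal (Real.exp (-2)) * ENNReal.ofReal (Real.exp (u ω ^ 2 / (48 * D))) :=
      fun ω => by
        rw [← ENNReal.ofReal_mul (Real.exp_pos _).le, ← Real.exp_add]
        ring_nf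
    simp only [e]
    rw [lintegral_const_mul' _ _ ENNReal.ofReal_ne_top]
    calc _ ≤ ENNReal.ofReal (Real.exp (-2)) * ENNReal.ofReal (Real.exp 2) := by gcongr
      _ = 1 := by
        rw [← ENNReal.ofReal_mul (Real.exp_pos _).le, ← Real.exp_add]
        simp
  -- The moment at scale 48D is at most exp 2; taking square roots lowers this to exp 1 and doubles
  -- the scale to 96D.
  refine (lintegral_mono fun ω => le_of_eq ?_).trans
    (lintegral_exp_mul_le_one hone (s := 1 / 2) (by norm_num) (by norm_num))
  congr 2
  field_simp
  ring

end SquareMoment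

/-! ### Sub-Gaussianity and the stochastic problem for averaged samples -/

section Minibatch

variable {E : Type*} [NormedAddCommGroup E] [InnerProductSpace ℝ E] [FiniteDimensional ℝ E]
  [CompleteSpace E] [MeasurableSpace E] [BorelSpace E] {Ω : Type*} [MeasurableSpace Ω]
  {P : Measure Ω} [IsProbabilityMeasure P] {p : Seminorm ℝ E} {θ : E → ℝ} {dθ : E → E}

/-- Exponential moments of the conjugate norm of a sum of independent centered vectors. -/
theorem lintegral_exp_dualNorm_sum_le [Nontrivial E] {S : Type*} [MeasurableSpace S]
    {μ : Measure S} [IsProbabilityMeasure μ]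
    (hp : ∀ x : E, p x = 0 → x = 0) (hθ : IsDGF p θ dθ)
    {ξ : ℕ → S → Ω} (hξ : IsSampleSequence μ P ξ) {η : Ω → E} (hη : Measurable η)
    (hint : Integrable η P) (h0 : ∫ ω, η ω ∂P = 0)
    (hsub : ∫⁻ ω, ENNReal.ofReal (Real.exp (dualNorm p (η ω) ^ 2 - 1)) ∂P ≤ 1)
    {n : ℕ} (hn : 1 ≤ n) {l : ℝ} (hl : 0 ≤ l) :
    ∫⁻ s, ENNReal.ofReal (Real.exp (l * dualNorm p (∑ i ∈ Finset.range n, η (ξ i s)))) ∂μ ≤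
      ENNReal.ofReal (Real.exp (1 + 6 * l ^ 2 * (n * bigTheta p θ))) := by
  have hn0 : (1 : ℝ) ≤ n := by exact_mod_cast hn
  have hΘ := half_le_bigTheta hp hθ
  set Θ := bigTheta p θ with hΘdef
  have hΘ0 : 0 < Θ := by linarith
  -- `r` balances the smoothing error βΘ against the quadratic terms n/(2β). Adding `l` to it
  -- ensures l/β ≤ 1, so that only a power at most one of the moment hypothesis is needed.
  set r := Real.sqrt (n / Θ) with hr
  have hr0 : 0 < r := Real.sqrt_pos.2 (by positivity)
  have hrsq : r ^ 2 * Θ = n := by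
    rw [hr, Real.sq_sqrt (by positivity)]; field_simp
  set β := l + r with hβ
  have hβ0 : 0 < β := by positivity
  -- Equal weights: the linear part is taken with parameter 2l, so halving restores `l` and leaves
  -- the compensator 2l². The square gets coefficient l/(2β), as in the potential estimate.
  let A : E → Ω → ℝ := fun y ω =>
    1 / 2 * (2 * l * inner ℝ (potentialGrad p θ β y) (η ω) - (2 * l) ^ 2) +
      (1 - 1 / 2) * (l / β * (dualNorm p (η ω) ^ 2 - 1))
  have hTm := (potentialGrad_continuous hp hθ β).measurable
  have hdm := (dualNorm_continuous p hp).measurable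
  have hAm : Measurable (Function.uncurry A) := by
    have h1 : Measurable fun q : E × Ω => (inner ℝ (potentialGrad p θ β q.1) (η q.2) : ℝ) :=
      (hTm.comp measurable_fst).inner (hη.comp measurable_snd)
    have h2 : Measurable fun q : E × Ω => dualNorm p (η q.2) :=
      hdm.comp (hη.comp measurable_snd)
    exact (((h1.const_mul _).sub_const _).const_mul _).add
      ((((h2.pow_const 2).sub_const 1).const_mul _).const_mul _)
  have hU : Measurable fun ω => dualNorm p (η ω) := hdm.comp hη
  have hA1 : ∀ y, ∫⁻ ω, ENNReal.ofReal (Real.exp (A y ω)) ∂P ≤ 1 := fun y => by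
    have hin : Measurable fun ω => (inner ℝ (potentialGrad p θ β y) (η ω) : ℝ) :=
      hη.const_inner
    refine lintegral_exp_comb_le_one (by fun_prop) ?_ ?_ (by norm_num) (by norm_num)
    · refine lintegral_exp_centered_le_one (hint.const_inner _) ?_ hU (fun ω => ?_) hsub _
      · rw [integral_inner hint, h0, inner_zero_right]
      · have h1 := abs_inner_le_dualNorm_mul p hp (η ω) (potentialGrad p θ β y)
        rw [real_inner_comm]
        exact h1.trans (mul_le_of_le_one_right (dualNorm_nonneg p hp _)
          (potentialGrad_spec hp hθ β y).1)
    · refine lintegral_exp_mul_le_one hsub (by positivity) ?_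
      rw [div_le_one hβ0]
      linarith
  obtain ⟨-, hle⟩ := lintegral_prod_process_le_one hξ (step := fun y ω => y + η ω)
    (measurable_fst.add (hη.comp measurable_snd))
    (y := fun n s => ∑ i ∈ Finset.range n, η (ξ i s)) (y₀ := 0) (fun s => by simp)
    (fun i s => Finset.sum_range_succ _ _)
    (f := fun y ω => ENNReal.ofReal (Real.exp (A y ω)))
    (ENNReal.measurable_ofReal.comp (Real.measurable_exp.comp hAm)) hA1 n
  have heq : ∀ s, ∏ i ∈ Finset.range n,
      ENNReal.ofReal (Real.exp (A (∑ j ∈ Finset.range i, η (ξ j s)) (ξ i s))) =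
      ENNReal.ofReal (Real.exp (∑ i ∈ Finset.range n,
        A (∑ j ∈ Finset.range i, η (ξ j s)) (ξ i s))) := fun s => by
    rw [Real.exp_sum, ENNReal.ofReal_prod_of_nonneg fun _ _ => (Real.exp_pos _).le]
  simp only [heq] at hle
  have hpt : ∀ s, l * dualNorm p (∑ i ∈ Finset.range n, η (ξ i s)) ≤
      1 + 6 * l ^ 2 * (n * Θ) +
        ∑ i ∈ Finset.range n, A (∑ j ∈ Finset.range i, η (ξ j s)) (ξ i s) := fun s => by
    have h1 := mul_le_mul_of_nonneg_left
      (dualNorm_sum_le_potential hp hθ hβ0 (fun i => η (ξ i s)) n) hl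
    have h2 : ∑ i ∈ Finset.range n, A (∑ j ∈ Finset.range i, η (ξ j s)) (ξ i s) =
        l * ∑ i ∈ Finset.range n,
          (inner ℝ (potentialGrad p θ β (∑ j ∈ Finset.range i, η (ξ j s))) (η (ξ i s)) +
            dualNorm p (η (ξ i s)) ^ 2 / (2 * β)) - n * (2 * l ^ 2 + l / (2 * β)) := by
      have : (n : ℝ) * (2 * l ^ 2 + l / (2 * β)) =
          ∑ i ∈ Finset.range n, (2 * l ^ 2 + l / (2 * β)) := by
        rw [Finset.sum_const, Finset.card_range, nsmul_eq_mul]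
      rw [this, Finset.mul_sum, ← Finset.sum_sub_distrib]
      refine Finset.sum_congr rfl fun i _ => ?_
      simp only [A]
      field_simp
      ring
    rw [mul_add] at h1
    rw [h2]
    have h3 : l * (β * Θ) = l ^ 2 * Θ + l * r * Θ := by rw [hβ]; ring
    have h4 : n * (l / (2 * β)) ≤ l * r * Θ / 2 := by
      rw [mul_div_assoc', div_le_iff₀ (by positivity), ← hrsq]
      have : 0 ≤ l * r * Θ * l := by positivity
      rw [hβ]
      nlinarith
    have h5 : (l * r * Θ) ^ 2 = l ^ 2 * (n * Θ) := by rw [← hrsq]; ring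
    have h6 : l ^ 2 * Θ ≤ l ^ 2 * (n * Θ) :=
      mul_le_mul_of_nonneg_left (le_mul_of_one_le_left hΘ0.le hn0) (sq_nonneg l)
    have h7 : 2 * l ^ 2 * n ≤ 4 * (l ^ 2 * (n * Θ)) := by
      have : 0 ≤ l ^ 2 * n := by positivity
      nlinarith
    -- With v = l²nΘ, the total is at most v + (3/2)√v + 4v, and (3/2)√v ≤ 1 + (9/16)v; hence the
    -- bound 1 + 6v.
    nlinarith [sq_nonneg (l * r * Θ - 4 / 3)]
  calc _ ≤ ∫⁻ s, ENNReal.ofReal (Real.exp (1 + 6 * l ^ 2 * (n * Θ))) *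
        ENNReal.ofReal (Real.exp (∑ i ∈ Finset.range n,
          A (∑ j ∈ Finset.range i, η (ξ j s)) (ξ i s))) ∂μ := by
        refine lintegral_mono fun s => ?_
        rw [← ENNReal.ofReal_mul (Real.exp_pos _).le, ← Real.exp_add]
        exact ENNReal.ofReal_le_ofReal (Real.exp_le_exp.2 (hpt s))
    _ ≤ ENNReal.ofReal (Real.exp (1 + 6 * l ^ 2 * (n * Θ))) * 1 := by
        rw [lintegral_const_mul' _ _ ENNReal.ofReal_ne_top]
        gcongr
    _ = _ := mul_one _

theorem isSampleSequence_infinitePi :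
    IsSampleSequence (Measure.infinitePi fun _ : ℕ => P) P (fun i ω => ω i) := by
  refine IsIIDSample.isSampleSequence ⟨?_, fun i => measurePreserving_eval_infinitePi _ i⟩
  exact iIndepFun_infinitePi (X := fun _ ω => ω) fun _ => measurable_id

theorem map_infinitePi_fin (L : ℕ) :
    (Measure.infinitePi fun _ : ℕ => P).map (fun ω (i : Fin L) => ω i) =
      Measure.pi fun _ : Fin L => P := by
  have h : iIndepFun (fun (i : ℕ) (ω : ℕ → Ω) => ω i) (Measure.infinitePi fun _ : ℕ => P) :=
    iIndepFun_infinitePi (X := fun _ ω => ω) fun _ => measurable_id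
  have h1 := h.precomp (g := fun i : Fin L => (i : ℕ)) Fin.val_injective
  rw [h1.map_fun_eq_pi_map fun i => (measurable_pi_apply _).aemeasurable]
  congr 1
  ext i : 1
  exact (measurePreserving_eval_infinitePi (fun _ : ℕ => P) i).map_eq

/-- The average of `L` independent centered sub-Gaussian vectors. -/
theorem isSubGaussian_average [Nontrivial E]
    (hp : ∀ x : E, p x = 0 → x = 0) (hθ : IsDGF p θ dθ) {η : Ω → E} (hη : Measurable η)
    (hint : Integrable η P) (h0 : ∫ ω, η ω ∂P = 0) {σ : ℝ} (hσ : 0 < σ)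
    (hsub : IsSubGaussian p P η σ) {L : ℕ} (hL : 1 ≤ L) :
    IsSubGaussian p (Measure.pi fun _ : Fin L => P)
      (fun ω => (L : ℝ)⁻¹ • ∑ l : Fin L, η (ω l))
      (Real.sqrt (96 * bigTheta p θ / L) * σ) := by
  have hL0 : (0 : ℝ) < L := by exact_mod_cast hL
  have hΘ := half_le_bigTheta hp hθ
  have hΘ0 : 0 < bigTheta p θ := by linarith
  have hdm := (dualNorm_continuous p hp).measurable
  have hsub' : ∫⁻ ω, ENNReal.ofReal (Real.exp (dualNorm p (σ⁻¹ • η ω) ^ 2 - 1)) ∂P ≤ 1 := by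
    refine (lintegral_mono fun ω => ENNReal.ofReal_le_ofReal (Real.exp_le_exp.2 ?_)).trans
      hsub.lintegral_le_one
    have h1 := dualNorm_smul_le p hp (inv_nonneg.2 hσ.le) (η ω)
    rw [inv_mul_eq_div] at h1
    have := pow_le_pow_left₀ (dualNorm_nonneg p hp _) h1 2
    linarith
  have hmeas : Measurable fun ω : ℕ → Ω =>
      dualNorm p (∑ i ∈ Finset.range L, σ⁻¹ • η (ω i)) := by
    refine hdm.comp (Finset.measurable_sum _ fun i _ => ?_)
    exact (hη.comp (measurable_pi_apply i)).const_smul σ⁻¹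
  have hexp := lintegral_exp_sq_le_one hmeas (fun _ => dualNorm_nonneg p hp _)
    (D := L * bigTheta p θ) (by positivity) fun l hl =>
      lintegral_exp_dualNorm_sum_le hp hθ (isSampleSequence_infinitePi (P := P))
        (hη.const_smul σ⁻¹) (hint.smul σ⁻¹) (by
          simp only [Pi.smul_apply]
          rw [integral_smul, h0, smul_zero]) hsub' hL hl
  have hm2 : Measurable fun ω : Fin L → Ω => ENNReal.ofReal (Real.exp
      (dualNorm p ((L : ℝ)⁻¹ • ∑ l : Fin L, η (ω l)) ^ 2 /
        (Real.sqrt (96 * bigTheta p θ / L) * σ) ^ 2)) := by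
    have h1 : Measurable fun ω : Fin L → Ω => (L : ℝ)⁻¹ • ∑ l : Fin L, η (ω l) :=
      (Finset.measurable_sum _ fun l _ => hη.comp (measurable_pi_apply l)).const_smul _
    have := hdm.comp h1
    fun_prop
  -- The block is realized as the first `L` coordinates of an infinite product, where the estimate
  -- for sample sequences applies.
  rw [IsSubGaussian, ← map_infinitePi_fin, lintegral_map hm2 (by fun_prop)]
  have hpt : ∀ ω : ℕ → Ω, dualNorm p ((L : ℝ)⁻¹ • ∑ l : Fin L, η (ω l)) ^ 2 /
      (Real.sqrt (96 * bigTheta p θ / L) * σ) ^ 2 ≤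
      1 + (dualNorm p (∑ i ∈ Finset.range L, σ⁻¹ • η (ω i)) ^ 2 /
        (96 * (L * bigTheta p θ)) - 1) := fun ω => by
    have e : (L : ℝ)⁻¹ • ∑ l : Fin L, η (ω l) =
        (σ / L) • ∑ i ∈ Finset.range L, σ⁻¹ • η (ω i) := by
      rw [Fin.sum_univ_eq_sum_range (fun i => η (ω i)) L, ← Finset.smul_sum, smul_smul]
      congr 1
      field_simp
    have h1 := dualNorm_smul_le p hp (by positivity : 0 ≤ σ / L)
      (∑ i ∈ Finset.range L, σ⁻¹ • η (ω i))
    rw [e, mul_pow, Real.sq_sqrt (by positivity), add_sub_cancel]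
    refine (div_le_div_of_nonneg_right (pow_le_pow_left₀ (dualNorm_nonneg p hp _) h1 2)
      (by positivity)).trans (le_of_eq ?_)
    field_simp
  calc _ ≤ ∫⁻ ω : ℕ → Ω, ENNReal.ofReal (Real.exp 1) * ENNReal.ofReal (Real.exp
        (dualNorm p (∑ i ∈ Finset.range L, σ⁻¹ • η (ω i)) ^ 2 /
          (96 * (L * bigTheta p θ)) - 1)) ∂(Measure.infinitePi fun _ : ℕ => P) := by
        refine lintegral_mono fun ω => ?_
        rw [← ENNReal.ofReal_mul (Real.exp_pos _).le, ← Real.exp_add]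
        exact ENNReal.ofReal_le_ofReal (Real.exp_le_exp.2 (hpt ω))
    _ ≤ ENNReal.ofReal (Real.exp 1) * 1 := by
        rw [lintegral_const_mul' _ _ ENNReal.ofReal_ne_top]
        gcongr
    _ = _ := mul_one _

theorem integral_average {F : Type*} [NormedAddCommGroup F] [NormedSpace ℝ F] [CompleteSpace F]
    {f : Ω → F} (hf : Integrable f P) {L : ℕ} (hL : 1 ≤ L) :
    Integrable (fun ω : Fin L → Ω => (L : ℝ)⁻¹ • ∑ l : Fin L, f (ω l))
        (Measure.pi fun _ : Fin L => P) ∧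
      ∫ ω : Fin L → Ω, (L : ℝ)⁻¹ • ∑ l : Fin L, f (ω l) ∂(Measure.pi fun _ : Fin L => P) =
        ∫ ω, f ω ∂P := by
  have hL0 : (L : ℝ) ≠ 0 := by positivity
  have hmp := fun l : Fin L => measurePreserving_eval (fun _ : Fin L => P) l
  have hi : ∀ l : Fin L, Integrable (fun ω : Fin L → Ω => f (ω l)) (Measure.pi fun _ => P) :=
    fun l => (hmp l).integrable_comp_of_integrable hf
  refine ⟨(integrable_finsetSum _ fun l _ => hi l).smul _, ?_⟩
  rw [integral_smul, integral_finsetSum _ fun l _ => hi l]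
  have hl : ∀ l : Fin L, ∫ ω : Fin L → Ω, f (ω l) ∂(Measure.pi fun _ => P) = ∫ ω, f ω ∂P :=
    fun l => by
      have h1 : AEStronglyMeasurable f
          ((Measure.pi fun _ : Fin L => P).map (Function.eval l)) := by
        rw [(hmp l).map_eq]; exact hf.aestronglyMeasurable
      have := integral_map (hmp l).measurable.aemeasurable h1
      rw [(hmp l).map_eq] at this
      exact this.symm
  simp only [hl, Finset.sum_const, Finset.card_univ, Fintype.card_fin]
  rw [← Nat.cast_smul_eq_nsmul ℝ, smul_smul, inv_mul_cancel₀ hL0, one_smul]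

/-- Averaging preserves convexity, the Lipschitz bound and the mean, so the plain theorem applies
verbatim on Ω^L. The objectives are identified on `X`, where `G` is integrable. -/
theorem isProblem_minibatch (hp : ∀ x : E, p x = 0 → x = 0)
    {X : Set E} {G : E → Ω → ℝ} {dG : E → Ω → E} {dg : E → E} {lip : Ω → ℝ} {ν : ℝ}
    (h : IsProblem p X P G dG dg lip ν) {L : ℕ} (hL : 1 ≤ L) :
    IsProblem p X (Measure.pi fun _ : Fin L => P)
      (fun x ω => (L : ℝ)⁻¹ • ∑ l : Fin L, G x (ω l))
      (fun x ω => (L : ℝ)⁻¹ • ∑ l : Fin L, dG x (ω l)) dg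
      (fun ω => (L : ℝ)⁻¹ * ∑ l : Fin L, lip (ω l)) ν ∧
    ∀ x ∈ X, objective (Measure.pi fun _ : Fin L => P)
      (fun x ω => (L : ℝ)⁻¹ • ∑ l : Fin L, G x (ω l)) x = objective P G x := by
  have hL0 : (0 : ℝ) < L := by exact_mod_cast hL
  have hobj : ∀ x ∈ X, objective (Measure.pi fun _ : Fin L => P)
      (fun x ω => (L : ℝ)⁻¹ • ∑ l : Fin L, G x (ω l)) x = objective P G x := fun x hx =>
    (integral_average (h.integrable x hx) hL).2
  refine ⟨?_, hobj⟩
  refine ⟨h.isClosed, h.convex, fun ω => ?_, fun ω x hx => ?_, fun ω x hx x' hx' => ?_, ?_,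
    fun x hx => (integral_average (h.integrable x hx) hL).1,
    h.mean_convexOn.congr fun x hx => (hobj x hx).symm,
    fun x hx => (h.mean_hasGradient x hx).congr hobj (hobj x hx), fun x hx => ?_,
    fun x hx => (integral_average (h.grad_integrable x hx) hL).1,
    fun x hx => (integral_average (h.grad_integrable x hx) hL).2.trans (h.unbiased x hx)⟩
  · refine ConvexOn.smul (by positivity) ?_
    refine ⟨h.convex, fun x hx y hy a b ha hb hab => ?_⟩
    rw [Finset.smul_sum, Finset.smul_sum, ← Finset.sum_add_distrib]
    exact Finset.sum_le_sum fun l _ => (h.convexOn (ω l)).2 hx hy ha hb hab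
  · rw [hasGradientWithinAt_iff_hasFDerivWithinAt]
    have h1 := (HasFDerivWithinAt.fun_sum (u := Finset.univ) fun (l : Fin L) _ =>
      hasGradientWithinAt_iff_hasFDerivWithinAt.1 (h.hasGradient (ω l) x hx)).const_smul (L : ℝ)⁻¹
    refine h1.congr_fderiv ?_
    ext v
    simp
  · rw [← smul_sub, ← Finset.sum_sub_distrib, mul_assoc, Finset.sum_mul]
    refine (dualNorm_smul_le p hp (by positivity) _).trans ?_
    refine mul_le_mul_of_nonneg_left ?_ (by positivity)
    exact (dualNorm_sum_le p hp _ _).trans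
      (Finset.sum_le_sum fun l _ => h.lipschitz (ω l) x hx x' hx')
  · have : ∀ᵐ ω ∂(Measure.pi fun _ : Fin L => P), ∀ l : Fin L, lip (ω l) ≤ ν :=
      ae_all_iff.2 fun l =>
        (measurePreserving_eval (fun _ : Fin L => P) l).quasiMeasurePreserving.ae h.lip_le
    filter_upwards [this] with ω hω
    rw [inv_mul_le_iff₀ hL0]
    calc ∑ l : Fin L, lip (ω l) ≤ ∑ _l : Fin L, ν := Finset.sum_le_sum fun l _ => hω l
      _ = L * ν := by simp
  · exact (Finset.measurable_sum _ fun l _ =>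
      (h.grad_measurable x hx).comp (measurable_pi_apply l)).const_smul _

end Minibatch

/-! ### High-probability bound for minibatch CSMD -/

section MinibatchBound

variable {E : Type*} [NormedAddCommGroup E] [InnerProductSpace ℝ E] [FiniteDimensional ℝ E]
  [CompleteSpace E] [MeasurableSpace E] [BorelSpace E] {Ω : Type*} [MeasurableSpace Ω]
  {P : Measure Ω} [IsProbabilityMeasure P]

theorem minibatch_bound [Nontrivial E]
    {S : Type*} [MeasurableSpace S] {μ : Measure S} [IsProbabilityMeasure μ]
    {p : Seminorm ℝ E} (hp : ∀ x : E, p x = 0 → x = 0)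
    {θ : E → ℝ} {dθ : E → E} (hθ : IsDGF p θ dθ)
    {X : Set E} {G : E → Ω → ℝ} {dG : E → Ω → E} {dg : E → E} {lip : Ω → ℝ} {ν : ℝ}
    (hν : 0 < ν) (h : IsProblem p X P G dG dg lip ν)
    {R κ γ σ : ℝ} (hR : 0 < R) (hκ : 0 ≤ κ) (hγ : 0 < γ) (hγν : γ ≤ (4 * ν)⁻¹) (hσ : 0 < σ)
    {x₀ xs : E} (hx₀ : x₀ ∈ X) (hxs : xs ∈ localBall p X x₀ R)
    (hgrad : dg xs = 0) (hsub : IsSubGaussian p P (dG xs) σ)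
    {m : ℕ} (hm : 1 ≤ m) {t : ℝ} (ht : 0 ≤ t) {L : ℕ} (hL : 1 ≤ L)
    {ξ : ℕ → Fin L → S → Ω} (hξ : IsIIDSample μ P (fun q : ℕ × Fin L => ξ q.1 q.2)) :
    ENNReal.ofReal (1 - Real.exp (-t)) ≤
      μ {s : S |
        compositeObjective P G p κ
            (approxSol p X θ dθ x₀ R (fun z => κ * p z) (fun _ => γ)
              (miniOracle dG L (fun i l => ξ i l s)) m)
          - compositeObjective P G p κ xs
        ≤ 384 * ((m : ℝ)⁻¹ * (γ⁻¹ * R ^ 2 * (bigTheta p θ + t) + κ * R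
            + γ * (σ ^ 2 * bigTheta p θ / L) * (m + t)))} := by
  obtain ⟨hprob, hobj⟩ := isProblem_minibatch hp h hL
  have hL0 : (0 : ℝ) < L := by exact_mod_cast hL
  have hm0 : (0 : ℝ) < m := by exact_mod_cast hm
  have hΘ0 : 0 < bigTheta p θ := by linarith [half_le_bigTheta hp hθ]
  have hpc := seminorm_continuous p
  have hmean : ∫ ω, dG xs ω ∂P = 0 := (h.unbiased xs hxs.1).trans hgrad
  have hsub' := isSubGaussian_average hp hθ (h.grad_measurable xs hxs.1)
    (h.grad_integrable xs hxs.1) hmean hσ hsub hL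
  have hmain := csmd_bound hp hθ hν hprob hR hκ hγ hγν
    (by positivity : 0 < Real.sqrt (96 * bigTheta p θ / L) * σ) hx₀ hxs hgrad hsub' hm ht
    hξ.isSampleSequence_block
  refine hmain.trans (measure_mono fun s hs => ?_)
  have hs' : compositeObjective (Measure.pi fun _ : Fin L => P)
        (fun x ω => (L : ℝ)⁻¹ • ∑ l : Fin L, G x (ω l)) p κ
        (approxSol p X θ dθ x₀ R (fun z => κ * p z) (fun _ => γ)
          (miniOracle dG L (fun i l => ξ i l s)) m)
      - compositeObjective (Measure.pi fun _ : Fin L => P)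
        (fun x ω => (L : ℝ)⁻¹ • ∑ l : Fin L, G x (ω l)) p κ xs ≤ _ := hs
  have hmem := approxSol_mem (p := p) (θ := θ) (dθ := dθ) (x₀ := x₀) (R := R) h.convex hγ hm
    fun i => (iter_mem hp hθ h.isClosed hx₀ hR (by fun_prop : Continuous fun z => κ * p z)
      (fun _ => γ) (miniOracle dG L (fun i l => ξ i l s)) i).1
  rw [compositeObjective, compositeObjective, hobj _ hmem, hobj _ hxs.1] at hs'
  refine hs'.trans ?_
  rw [mul_pow, Real.sq_sqrt (by positivity)]
  have p1 : 0 ≤ γ⁻¹ * R ^ 2 * (bigTheta p θ + t) := by positivity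
  have p2 : 0 ≤ κ * R := by positivity
  -- The constant 384 is the plain constant 4 times the variance factor 96.
  have e : γ * (96 * bigTheta p θ / L * σ ^ 2) * (m + t) =
      96 * (γ * (σ ^ 2 * bigTheta p θ / L) * (m + t)) := by ring
  rw [e, mul_left_comm, mul_left_comm (384 : ℝ)]
  refine mul_le_mul_of_nonneg_left ?_ (by positivity)
  linarith

end MinibatchBound

end CSMD

theorem proposition1 :
    ∃ c C : ℝ, 0 < c ∧ 0 < C ∧
      ∀ (E : Type*) [NormedAddCommGroup E] [InnerProductSpace ℝ E] [FiniteDimensional ℝ E]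
        [CompleteSpace E] [MeasurableSpace E] [BorelSpace E]
        (Ω : Type*) [MeasurableSpace Ω] (P : MeasureTheory.Measure Ω)
        [MeasureTheory.IsProbabilityMeasure P]
        (S : Type*) [MeasurableSpace S] (μ : MeasureTheory.Measure S)
        [MeasureTheory.IsProbabilityMeasure μ]
        (p : Seminorm ℝ E) (_ : ∀ x : E, p x = 0 → x = 0)
        (θ : E → ℝ) (dθ : E → E) (_ : CSMD.IsDGF p θ dθ)
        (X : Set E) (G : E → Ω → ℝ) (dG : E → Ω → E) (dg : E → E) (lip : Ω → ℝ) (ν : ℝ)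
        (_ : 0 < ν) (_ : CSMD.IsProblem p X P G dG dg lip ν)
        (R κ γ σ : ℝ) (_ : 0 < R) (_ : 0 ≤ κ) (_ : 0 < γ) (_ : γ ≤ (4 * ν)⁻¹) (_ : 0 < σ)
        (x₀ xs : E) (_ : x₀ ∈ X) (_ : xs ∈ CSMD.localBall p X x₀ R)
        (_ : dg xs = 0) (_ : CSMD.IsSubGaussian p P (dG xs) σ)
        (m : ℕ) (_ : 1 ≤ m) (t : ℝ) (_ : c * Real.sqrt (1 + Real.log m) ≤ t),
        (∀ ξ : ℕ → S → Ω, CSMD.IsIIDSample μ P ξ →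
          ENNReal.ofReal (1 - 4 * Real.exp (-t)) ≤
            μ {s : S |
              CSMD.compositeObjective P G p κ
                  (CSMD.approxSol p X θ dθ x₀ R (fun z => κ * p z) (fun _ => γ)
                    (CSMD.oracle dG (fun i => ξ i s)) m)
                - CSMD.compositeObjective P G p κ xs
              ≤ C * ((m : ℝ)⁻¹ * (γ⁻¹ * R ^ 2 * (CSMD.bigTheta p θ + t) + κ * R
                  + γ * σ ^ 2 * (m + t)))}) ∧
        (∀ L : ℕ, 1 ≤ L → ∀ ξ : ℕ → Fin L → S → Ω,
          CSMD.IsIIDSample μ P (fun q : ℕ × Fin L => ξ q.1 q.2) →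
          ENNReal.ofReal (1 - 4 * Real.exp (-t)) ≤
            μ {s : S |
              CSMD.compositeObjective P G p κ
                  (CSMD.approxSol p X θ dθ x₀ R (fun z => κ * p z) (fun _ => γ)
                    (CSMD.miniOracle dG L (fun i l => ξ i l s)) m)
                - CSMD.compositeObjective P G p κ xs
              ≤ C * ((m : ℝ)⁻¹ * (γ⁻¹ * R ^ 2 * (CSMD.bigTheta p θ + t) + κ * R
                  + γ * (σ ^ 2 * CSMD.bigTheta p θ / L) * (m + t)))}) := by
  -- The constant c = 1 serves to make `t` nonnegative; 384 is the larger of the plain and minibatch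
  -- constants.
  refine ⟨1, 384, one_pos, by norm_num, ?_⟩
  intro E _ _ _ _ _ _ Ω _ P _ S _ μ _ p hp θ dθ hθ X G dG dg lip ν hν h R κ γ σ hR hκ hγ hγν hσ
    x₀ xs hx₀ hxs hgrad hsub m hm t htm
  have ht : 0 ≤ t := le_trans (by positivity) htm
  have hprob : ENNReal.ofReal (1 - 4 * Real.exp (-t)) ≤ ENNReal.ofReal (1 - Real.exp (-t)) :=
    ENNReal.ofReal_le_ofReal (by linarith [Real.exp_pos (-t)])
  have hΘ := CSMD.bigTheta_nonneg hp hθ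
  have hm0 : (0 : ℝ) < m := by exact_mod_cast hm
  refine ⟨fun ξ hξ => ?_, fun L hL ξ hξ => ?_⟩
  · refine (hprob.trans (CSMD.csmd_bound hp hθ hν h hR hκ hγ hγν hσ hx₀ hxs hgrad hsub hm ht
      hξ.isSampleSequence)).trans (MeasureTheory.measure_mono fun s hs => hs.out.trans ?_)
    exact mul_le_mul_of_nonneg_right (by norm_num) (by positivity)
  · rcases subsingleton_or_nontrivial E with hE | hE
    · refine (ENNReal.ofReal_le_ofReal (by linarith [Real.exp_pos (-t)] :
        1 - 4 * Real.exp (-t) ≤ 1)).trans ?_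
      rw [ENNReal.ofReal_one, ← MeasureTheory.measure_univ (μ := μ)]
      refine MeasureTheory.measure_mono fun s _ => ?_
      rw [Set.mem_ofPred_eq, Subsingleton.elim (CSMD.approxSol _ _ _ _ _ _ _ _ _ _) xs, sub_self]
      positivity
    · exact hprob.trans (CSMD.minibatch_bound hp hθ hν h hR hκ hγ hγν hσ hx₀ hxs hgrad hsub hm ht
        hL hξ)
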